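/- Let $A\in\mathbb{C}^{n\times n}$ have all its eigenvalues in the open unit disc, let $b\in\mathbb{C}^{n}$ be nonzero, and suppose that $(A,b)$ is reachable, i.e. $b,Ab,\dots,A^{n-1}b$ span $\mathbb{C}^n$. Put $G(z)=(zI-A)^{-1}b$, and on the unit circle $\mathbb{T}$ let $G^*$ denote the conjugate transpose of $G$. All integrals below are over $\mathbb{T}$ with respect to the normalized Lebesgue measure $d\vartheta/2\pi$. Let $$P_\Gamma=\Big\{\Sigma\in\mathbb{C}^{n\times n}\ :\ \Sigma=\Sigma^*>0,\ \Sigma=\int G\Phi G^*\ \text{for some continuous } \Phi:\mathbb{T}\to\mathbb{R}\Big\}.$$ Let $\mathcal{S}_+(\mathbb{T})$ be the set of $\Phi\in L_\infty(\mathbb{T};\mathbb{R})$ with $\Phi\ge c$ a.e. for some constant $c>0$ (bounded coercive spectral densities), and fix $\Psi\in\mathcal{S}_+(\mathbb{T})$. Then for every $\Sigma\in P_\Gamma$ the problem of minimizing the Kullback–Leibler pseudo-distance $$\mathbb{D}(\Psi\|\Phi)=\int\Psi\log\frac{\Psi}{\Phi}\qquad\text{over}\qquad\Big\{\Phi\in\mathcal{S}_+(\mathbb{T})\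 :\ \int G\Phi G^*=\Sigma\Big\}$$ has exactly one solution, denoted $\Phi_{\rm opt}^{KL}(\Sigma)$, and it is consistently estimated in the following sense. Let $x_1,x_2,\dots$ be $\mathbb{C}^n$-valued random vectors on a probability space, let $\Sigma\in P_\Gamma$, and for each $N\ge1$ let $\bar\Sigma(x_1,\dots,x_N)$ be an estimator with values in $P_\Gamma$ almost surely. If $$\lim_{N\to\infty}\bar\Sigma(x_1,\dots,x_N)=\Sigma\quad\text{a.s.},$$ then $$\lim_{N\to\infty}\big\|\Phi_{\rm opt}^{KL}(\bar\Sigma(x_1,\dots,x_N))-\Phi_{\rm opt}^{KL}(\Sigma)\big\|_\infty=0\quad\text{a.s.}$$ -/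

import Mathlib

open MeasureTheory Filter Topology
open scoped ENNReal Matrix ComplexOrder

namespace KLSpectrum

noncomputable section

/-- The unit circle, parametrized by the angle `ϑ` modulo `2π`. -/
abbrev Torus : Type := AddCircle (2 * Real.pi)

/-- The period is positive. -/
instance instFactTwoPiPos : Fact ((0 : ℝ) < 2 * Real.pi) := ⟨Real.two_pi_pos⟩

/-- The normalized Lebesgue measure `dϑ / 2π` on the unit circle. -/
def circleMeasure : Measure Torus := AddCircle.haarAddCircle

/-- The point `e^{iϑ}` of the complex plane. -/
def circlePoint (ϑ : Torus) : ℂ := (AddCircle.toCircle ϑ : ℂ)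

/-- `A` is a stability matrix (discrete time): all eigenvalues lie in the open unit disc. -/
def IsStability {n : ℕ} (A : Matrix (Fin n) (Fin n) ℂ) : Prop :=
  ∀ μ ∈ spectrum ℂ A, ‖μ‖ < 1

/-- The pair `(A, b)` is reachable: the vectors `b, A b, …, A ^ (n - 1) b` span `ℂⁿ`. -/
def IsReachable {n : ℕ} (A : Matrix (Fin n) (Fin n) ℂ) (b : Fin n → ℂ) : Prop :=
  Submodule.span ℂ (Set.range fun k : Fin n => (A ^ (k : ℕ)) *ᵥ b) = ⊤

/-- The transfer function `G(z) = (zI - A)⁻¹ b` of `x(t+1) = A x(t) + b y(t)`, with scalar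
input `y`. -/
def transfer {n : ℕ} (A : Matrix (Fin n) (Fin n) ℂ) (b : Fin n → ℂ) (z : ℂ) : Fin n → ℂ :=
  (z • (1 : Matrix (Fin n) (Fin n) ℂ) - A)⁻¹ *ᵥ b

/-- The matrix `∫ G Φ G^*` for a scalar function `Φ` on the circle, computed entry by entry. Here
`G^*(e^{iϑ})` is the conjugate transpose of the column `G(e^{iϑ})`. -/
def stateCov {n : ℕ} (A : Matrix (Fin n) (Fin n) ℂ) (b : Fin n → ℂ) (Φ : Torus → ℝ) :
    Matrix (Fin n) (Fin n) ℂ :=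
  Matrix.of fun i j =>
    ∫ ϑ, transfer A b (circlePoint ϑ) i * (Φ ϑ : ℂ) * star (transfer A b (circlePoint ϑ) j)
      ∂circleMeasure

/-- `P_Γ`: the positive definite Hermitian matrices in the range of `Φ ↦ ∫ G Φ G^*`, where `Φ`
ranges over the continuous real functions on the circle. -/
def PGamma {n : ℕ} (A : Matrix (Fin n) (Fin n) ℂ) (b : Fin n → ℂ) :
    Set (Matrix (Fin n) (Fin n) ℂ) :=
  {S | S.PosDef ∧ ∃ Φ : C(Torus, ℝ), stateCov A b Φ = S}

/-- The space `L_∞` of the unit circle. -/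
abbrev LInf : Type := Lp ℝ ∞ circleMeasure

/-- The bounded, coercive scalar spectral densities on the unit circle. -/
def spectralDensities : Set LInf :=
  {Φ | ∃ c : ℝ, 0 < c ∧ ∀ᵐ ϑ ∂circleMeasure, c ≤ Φ ϑ}

/-- The Kullback-Leibler pseudo-distance `𝔻(Ψ‖Φ) = ∫ Ψ log (Ψ / Φ)`. -/
def klDist (Ψ Φ : LInf) : ℝ :=
  ∫ ϑ, Ψ ϑ * Real.log (Ψ ϑ / Φ ϑ) ∂circleMeasure

/-- The bounded, coercive spectral densities that satisfy the moment constraint `∫ G Φ G^* = S`. -/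
def feasible {n : ℕ} (A : Matrix (Fin n) (Fin n) ℂ) (b : Fin n → ℂ)
    (S : Matrix (Fin n) (Fin n) ℂ) : Set LInf :=
  {Φ | Φ ∈ spectralDensities ∧ stateCov A b Φ = S}

/-- `Φ` solves the approximation problem: minimize `𝔻(Ψ‖Φ)` over the feasible `Φ`. -/
def IsKLSolution {n : ℕ} (A : Matrix (Fin n) (Fin n) ℂ) (b : Fin n → ℂ) (Ψ : LInf)
    (S : Matrix (Fin n) (Fin n) ℂ) (Φ : LInf) : Prop :=
  Φ ∈ feasible A b S ∧ ∀ Φ' ∈ feasible A b S, klDist Ψ Φ ≤ klDist Ψ Φ'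

open Classical in
/-- The optimal spectrum for the covariance `S`: the solution of the approximation problem
(and `0` where there is none). -/
def klOpt {n : ℕ} (A : Matrix (Fin n) (Fin n) ℂ) (b : Fin n → ℂ) (Ψ : LInf)
    (S : Matrix (Fin n) (Fin n) ℂ) : LInf :=
  if h : ∃ Φ, IsKLSolution A b Ψ S Φ then h.choose else 0

end

end KLSpectrum

namespace KLSpectrum

/-! ### Fejér–Riesz factorization of nonnegative trigonometric polynomials. -/

section FejerRiesz

open Polynomial ComplexConjugate

/-! The minimizer has the form Ψ/q with q = Re(G^*ΛG), where q minimizes the dual functional L q −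
∫Ψ log q over positive q, and L q = Re tr(ΛΣ). Stationarity, ∫(Ψ/q)p = L p for all p, is the moment
constraint for Ψ/q. For any other feasible Φ' the constraint gives ∫Φ'q = ∫Ψ, so the two
pseudo-distances differ by ∫Ψ(x − 1 − log x) with x = Φ'q/Ψ. This is nonnegative, and zero only if
Φ' = Ψ/q a.e., whence optimality and uniqueness (`isKLSolution_of_isStationary`).

Solving the dual problem (`exists_isStationary`) rests on two facts. First, L is positive on nonzero
nonnegative q: by Fejér–Riesz and reachability q = |a·G|² for a vector a, and then L q = aᵀΣā > 0
(`tracePairing_pos_of_mem_PGamma`); by compactness L q controls ‖q‖. Second, the functions q are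
Lipschitz in the angle, so ∫1/q blows up logarithmically as min q → 0; a bound on this integral
keeps q away from zero (`exists_lower_bound`).

Consistency is a deterministic continuity statement, applied path by path. Subtracting the
stationarity conditions of q and q' gives (L − L')(q' − q) = ∫Ψ(q' − q)²/(qq'). The right side
dominates a multiple of ‖q' − q‖², so q depends on Σ in a locally Lipschitz way
(`IsStationary.exists_norm_sub_le`), and Ψ/q then varies continuously in the supremum norm. -/

theorem infinite_unit_circle : {z : ℂ | ‖z‖ = 1}.Infinite := by
  have h1 : Set.InjOn Circle.exp (Set.Icc 0 1) :=
    Circle.exp_injOn_Icc (by linarith [Real.pi_gt_three])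
  have h2 : Set.InjOn (fun t : ℝ => (Circle.exp t : ℂ)) (Set.Icc 0 1) :=
    fun s hs t ht hst => h1 hs ht (Subtype.ext hst)
  refine ((Set.Icc_infinite (zero_lt_one (α := ℝ))).image h2).mono ?_
  rintro _ ⟨t, -, rfl⟩
  simp

theorem polynomial_eq_of_eval_eq_on_circle {P Q : ℂ[X]}
    (h : ∀ z : ℂ, ‖z‖ = 1 → P.eval z = Q.eval z) : P = Q :=
  eq_of_infinite_eval_eq P Q (infinite_unit_circle.mono fun z hz => h z hz)

/-- Since 1/z̄ = z on the circle, the reversed conjugate polynomial takes the value z^N conj(P z)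
there: conjugation becomes a polynomial operation. -/
theorem eval_reflect_map_conj {N : ℕ} {P : ℂ[X]} (hP : P.natDegree ≤ N) {z : ℂ} (hz : z ≠ 0) :
    (reflect N (P.map (starRingEnd ℂ))).eval z = z ^ N * conj (P.eval (conj z)⁻¹) := by
  have hz' : z⁻¹ ≠ 0 := inv_ne_zero hz
  let _ := invertibleOfNonzero hz'
  have h := eval₂_reflect_mul_pow (RingHom.id ℂ) z⁻¹ N (P.map (starRingEnd ℂ))
    (natDegree_map_le.trans hP)
  have h1 : eval z⁻¹ (P.map (starRingEnd ℂ)) = conj (P.eval (conj z)⁻¹) := by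
    rw [show z⁻¹ = conj (conj z)⁻¹ by simp, eval_map, eval₂_hom]
  rw [← h1]
  simp only [invOf_eq_inv, inv_inv, eval₂_id] at h
  rw [← h, mul_comm, mul_assoc, ← mul_pow, inv_mul_cancel₀ hz, one_pow, mul_one]

theorem conj_inv_of_norm_one {z : ℂ} (hz : ‖z‖ = 1) : (conj z)⁻¹ = z := by
  rw [← Complex.inv_eq_conj hz, inv_inv]

theorem mul_conj_of_norm_one {z : ℂ} (hz : ‖z‖ = 1) : z * conj z = 1 := by
  rw [Complex.mul_conj, Complex.normSq_eq_norm_sq, hz]; simp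

theorem ne_zero_of_norm_one {z : ℂ} (hz : ‖z‖ = 1) : z ≠ 0 := by
  rintro rfl; simp at hz

/-- A polynomial `P` for which `z ^ (-d) P(z)` is real on the circle is self-reciprocal. -/
theorem reflect_map_conj_eq_self {d : ℕ} {P : ℂ[X]} (hP : P.natDegree ≤ 2 * d)
    (h : ∀ z : ℂ, ‖z‖ = 1 → 0 ≤ P.eval z * conj z ^ d) :
    reflect (2 * d) (P.map (starRingEnd ℂ)) = P := by
  refine polynomial_eq_of_eval_eq_on_circle fun z hz => ?_
  rw [eval_reflect_map_conj hP (ne_zero_of_norm_one hz), conj_inv_of_norm_one hz]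
  have h1 : conj (P.eval z * conj z ^ d) = P.eval z * conj z ^ d :=
    Complex.conj_eq_iff_im.2 (Complex.nonneg_iff.1 (h z hz)).2.symm
  have h2 : z ^ d * conj z ^ d = 1 := by rw [← mul_pow, mul_conj_of_norm_one hz, one_pow]
  rw [map_mul, map_pow, Complex.conj_conj] at h1
  calc z ^ (2 * d) * conj (P.eval z) = z ^ d * (conj (P.eval z) * z ^ d) := by ring
    _ = P.eval z * (z ^ d * conj z ^ d) := by rw [h1]; ring
    _ = _ := by rw [h2, mul_one]

/-- A nonnegative trigonometric polynomial has only multiple zeros on the circle. -/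
theorem derivative_eval_eq_zero_of_nonneg {d : ℕ} {P : ℂ[X]}
    (h : ∀ z : ℂ, ‖z‖ = 1 → 0 ≤ P.eval z * conj z ^ d) {w : ℂ} (hw : ‖w‖ = 1)
    (hPw : P.eval w = 0) : P.derivative.eval w = 0 := by
  set c : ℝ → ℂ := fun t => w * Complex.exp (t * Complex.I) with hc
  have hcn : ∀ t, ‖c t‖ = 1 := fun t => by simp [hc, hw, Complex.norm_exp_ofReal_mul_I]
  have hc0 : c 0 = w := by simp [hc]
  have hcd : HasDerivAt c (w * Complex.I) 0 := by
    have h1 : HasDerivAt (fun t : ℝ => (t : ℂ) * Complex.I) Complex.I 0 := by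
      simpa using (Complex.ofRealCLM.hasDerivAt (x := 0)).mul_const Complex.I
    simpa using h1.cexp.const_mul w
  have hcc : HasDerivAt (fun t => conj (c t)) (conj (w * Complex.I)) 0 := hcd.star
  have hP1 : HasDerivAt (fun t => P.eval (c t)) (P.derivative.eval w * (w * Complex.I)) 0 := by
    have := P.hasDerivAt (c 0)
    rw [hc0] at this
    exact HasDerivAt.comp (h₂ := fun z => P.eval z) 0 (by rw [hc0]; exact this) hcd
  have hg := hP1.mul (hcc.pow d)
  have hgv : ∀ t, 0 ≤ P.eval (c t) * conj (c t) ^ d := fun t => h _ (hcn t)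
  -- As P w = 0, only the term with P' survives in the derivative D. The differentiated function is
  -- real and minimal at t = 0, so both parts of D vanish.
  simp only [hc0, hPw, zero_mul, add_zero] at hg
  set D := P.derivative.eval w * (w * Complex.I) * conj w ^ d with hD
  have hg' : HasDerivAt (fun t => P.eval (c t) * conj (c t) ^ d) D 0 := by
    simp only [Pi.pow_apply, hc0] at hg
    exact hg
  have him : HasDerivAt (fun t => (P.eval (c t) * conj (c t) ^ d).im) D.im 0 :=
    Complex.imCLM.hasFDerivAt.comp_hasDerivAt 0 hg'
  have hre : HasDerivAt (fun t => (P.eval (c t) * conj (c t) ^ d).re) D.re 0 :=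
    Complex.reCLM.hasFDerivAt.comp_hasDerivAt 0 hg'
  have h1 : D.im = 0 := by
    have : (fun t => (P.eval (c t) * conj (c t) ^ d).im) = fun _ => 0 := by
      ext t; exact (Complex.nonneg_iff.1 (hgv t)).2.symm
    rw [this] at him
    exact him.unique (hasDerivAt_const _ _)
  have h2 : D.re = 0 := by
    refine IsLocalMin.hasDerivAt_eq_zero (Eventually.of_forall fun t => ?_) hre
    simp only [hc0, hPw, zero_mul, Complex.zero_re]
    exact (Complex.nonneg_iff.1 (hgv t)).1
  have h3 : D = 0 := Complex.ext h2 h1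
  have hw0 := ne_zero_of_norm_one hw
  simpa [hD, hw0] using h3

/-- A continuous function that is nonnegative on the punctured circle is so on the circle. -/
theorem nonneg_on_circle_of_ne {f : ℂ → ℂ} (hf : Continuous f) {w : ℂ}
    (h : ∀ z : ℂ, ‖z‖ = 1 → z ≠ w → 0 ≤ f z) : ∀ z : ℂ, ‖z‖ = 1 → 0 ≤ f z := by
  intro z hz
  rcases ne_or_eq z w with hzw | rfl
  · exact h z hz hzw
  set c : ℝ → ℂ := fun t => z * Complex.exp (t * Complex.I) with hc
  have hc0 : c 0 = z := by simp [hc]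
  have hcd : HasDerivAt c (z * Complex.I) 0 := by
    have h1 : HasDerivAt (fun t : ℝ => (t : ℂ) * Complex.I) Complex.I 0 := by
      simpa using (Complex.ofRealCLM.hasDerivAt (x := 0)).mul_const Complex.I
    simpa using h1.cexp.const_mul z
  have hne : ∀ᶠ t in 𝓝[≠] (0 : ℝ), c t ≠ z :=
    hcd.eventually_ne (mul_ne_zero (ne_zero_of_norm_one hz) Complex.I_ne_zero)
  have hlim : Tendsto (fun t => f (c t)) (𝓝[≠] 0) (𝓝 (f z)) := by
    have h1 : ContinuousAt (fun t => f (c t)) 0 := hf.continuousAt.comp hcd.continuousAt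
    have h2 := h1.tendsto
    rw [hc0] at h2
    exact h2.mono_left nhdsWithin_le_nhds
  refine ge_of_tendsto hlim (hne.mono fun t ht => h _ ?_ ht)
  simp [hc, hz, Complex.norm_exp_ofReal_mul_I]

/-- The Fejér–Riesz theorem: a trigonometric polynomial of degree at most `d` that is nonnegative
on the circle is the squared modulus of a polynomial of degree at most `d`. -/
theorem fejerRiesz {d : ℕ} {P : ℂ[X]} (hP : P.natDegree ≤ 2 * d)
    (h : ∀ z : ℂ, ‖z‖ = 1 → 0 ≤ P.eval z * conj z ^ d) :
    ∃ p : ℂ[X], p.natDegree ≤ d ∧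
      ∀ z : ℂ, ‖z‖ = 1 → P.eval z * conj z ^ d = ((‖p.eval z‖ ^ 2 : ℝ) : ℂ) := by
  induction d generalizing P with
  | zero =>
    obtain ⟨a, rfl⟩ : ∃ a, P = C a := ⟨_, eq_C_of_natDegree_le_zero (by simpa using hP)⟩
    have ha : 0 ≤ a := by simpa using h 1 (by simp)
    refine ⟨C ((Real.sqrt a.re : ℝ) : ℂ), by simp, fun z _ => ?_⟩
    obtain ⟨h1, h2⟩ := Complex.nonneg_iff.1 ha
    simp only [eval_C, pow_zero, mul_one, Complex.norm_real, Real.norm_eq_abs, sq_abs,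
      Real.sq_sqrt h1]
    exact Complex.ext rfl (by simp [← h2])
  | succ d ih =>
    have hrefl := reflect_map_conj_eq_self hP h
    -- A zero at 0 kills the constant coefficient and, by self-reciprocity, the one of degree 2(d +
    -- 1). Dividing by X thus lowers the degree bound by two, and on the circle X cancels one factor
    -- conj z.
    by_cases h0 : P.eval 0 = 0
    · obtain ⟨Q, rfl⟩ : X ∣ P := by rw [X_dvd_iff, coeff_zero_eq_eval_zero]; exact h0
      have hQ : Q.natDegree ≤ 2 * d := by
        rw [natDegree_le_iff_coeff_eq_zero]
        intro N hN
        have h1 : ∀ m, (X * Q).coeff m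
            = conj ((X * Q).coeff (revAt (2 * (d + 1)) m)) := fun m => by
          conv_lhs => rw [← hrefl, coeff_reflect, coeff_map]
        rcases Nat.lt_or_ge (2 * d + 1) N with h2 | h2
        · rw [← coeff_X_mul Q N]
          exact coeff_eq_zero_of_natDegree_lt (by omega)
        · obtain rfl : N = 2 * d + 1 := by omega
          rw [← coeff_X_mul Q (2 * d + 1), h1, revAt_le (by omega),
            show 2 * (d + 1) - (2 * d + 1 + 1) = 0 by omega]
          simp
      have hv : ∀ z : ℂ, ‖z‖ = 1 →
          (X * Q).eval z * conj z ^ (d + 1) = Q.eval z * conj z ^ d := fun z hz => by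
        rw [eval_mul, eval_X, pow_succ]
        linear_combination (Q.eval z * conj z ^ d) * mul_conj_of_norm_one hz
      obtain ⟨p, hp, hpv⟩ := ih hQ fun z hz => by rw [← hv z hz]; exact h z hz
      exact ⟨p, by omega, fun z hz => by rw [hv z hz, hpv z hz]⟩
    · have hdeg : P.degree ≠ 0 := by
        have h1 : P.coeff (2 * (d + 1)) ≠ 0 := by
          rw [← hrefl, coeff_reflect, coeff_map, revAt_le le_rfl, Nat.sub_self,
            coeff_zero_eq_eval_zero]
          simpa using h0
        have h2 := le_degree_of_ne_zero h1
        intro h3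
        rw [h3] at h2
        norm_cast at h2
      obtain ⟨w, hw⟩ := Complex.isAlgClosed.exists_root P hdeg
      have hw : P.eval w = 0 := hw
      have hw0 : w ≠ 0 := by rintro rfl; exact h0 hw
      have hcw0 : conj w ≠ 0 := by simpa using hw0
      -- Off the circle, self-reciprocity makes 1/w̄ a second root, distinct from w. On the circle
      -- 1/w̄ = w, and nonnegativity makes w a multiple root.
      have hdvd : ∃ Q, P = (X - C w) * ((X - C (conj w)⁻¹) * Q) := by
        obtain ⟨R, hR⟩ := dvd_iff_isRoot.2 hw
        have hRw : R.eval (conj w)⁻¹ = 0 := by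
          by_cases hw1 : ‖w‖ = 1
          · rw [conj_inv_of_norm_one hw1]
            have := derivative_eval_eq_zero_of_nonneg h hw1 hw
            rw [hR] at this
            simpa using this
          · have h1 : P.eval (conj w)⁻¹ = 0 := by
              rw [← hrefl, eval_reflect_map_conj hP (inv_ne_zero hcw0)]
              simp [hw]
            rw [hR, eval_mul] at h1
            refine (mul_eq_zero.1 h1).resolve_left fun h2 => hw1 ?_
            rw [eval_sub, eval_X, eval_C, sub_eq_zero] at h2
            have h3 : w * conj w = 1 := by 
              nth_rewrite 1 [← h2]
              exact inv_mul_cancel₀ hcw0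
            rw [Complex.mul_conj, Complex.normSq_eq_norm_sq] at h3
            have h4 : ‖w‖ ^ 2 = 1 := by exact_mod_cast h3
            nlinarith [norm_nonneg w]
        obtain ⟨Q, hQ⟩ := dvd_iff_isRoot.2 hRw
        exact ⟨Q, by rw [hR, hQ]⟩
      obtain ⟨Q, hQ⟩ := hdvd
      have hP0 : P ≠ 0 := by rintro rfl; simp at h0
      have hQ0 : Q ≠ 0 := by rintro rfl; simp at hQ; exact hP0 hQ
      have hQd : (C (-(conj w)⁻¹) * Q).natDegree ≤ 2 * d := by
        refine (natDegree_C_mul_le _ _).trans ?_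
        rw [hQ, natDegree_mul (X_sub_C_ne_zero _) (mul_ne_zero (X_sub_C_ne_zero _) hQ0),
          natDegree_mul (X_sub_C_ne_zero _) hQ0, natDegree_X_sub_C, natDegree_X_sub_C] at hP
        omega
      -- On the circle (z − w)(z − 1/w̄)z̄ = −|z − w|²/w̄. With the constant −1/w̄ absorbed, the
      -- quotient is nonnegative away from w, hence at w by continuity.
      have hv : ∀ z : ℂ, ‖z‖ = 1 → P.eval z * conj z ^ (d + 1)
          = ((‖z - w‖ ^ 2 : ℝ) : ℂ) * ((C (-(conj w)⁻¹) * Q).eval z * conj z ^ d) :=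
        fun z hz => by
        have h1 : ((‖z - w‖ ^ 2 : ℝ) : ℂ) = (z - w) * (conj z - conj w) := by
          rw [← map_sub, Complex.mul_conj, Complex.normSq_eq_norm_sq]
        have h2 : (z - (conj w)⁻¹) * conj z = (conj z - conj w) * (-(conj w)⁻¹) := by
          field_simp
          linear_combination (conj w) * mul_conj_of_norm_one hz
        rw [h1, hQ]
        simp only [eval_mul, eval_sub, eval_X, eval_C]
        rw [pow_succ]
        linear_combination ((z - w) * eval z Q * conj z ^ d) * h2
      have hnn : ∀ z : ℂ, ‖z‖ = 1 → 0 ≤ (C (-(conj w)⁻¹) * Q).eval z * conj z ^ d := by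
        refine nonneg_on_circle_of_ne (w := w) (by fun_prop) fun z hz hzw => ?_
        have h1 := h z hz
        rw [hv z hz] at h1
        have h2 : 0 < ‖z - w‖ ^ 2 := pow_pos (norm_pos_iff.2 (sub_ne_zero.2 hzw)) 2
        rw [Complex.nonneg_iff, Complex.re_ofReal_mul, Complex.im_ofReal_mul] at h1
        rw [Complex.nonneg_iff]
        exact ⟨nonneg_of_mul_nonneg_right h1.1 h2,
          ((mul_eq_zero.1 h1.2.symm).resolve_left h2.ne').symm⟩
      obtain ⟨p, hp, hpv⟩ := ih hQd hnn
      refine ⟨(X - C w) * p, ?_, fun z hz => ?_⟩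
      · refine natDegree_mul_le.trans ?_
        rw [natDegree_X_sub_C]; omega
      · rw [hv z hz, hpv z hz]
        simp only [eval_mul, eval_sub, eval_X, eval_C, norm_mul]
        push_cast
        ring

end FejerRiesz

/-! ### The transfer function as a rational function, and quadratic forms in it. -/

section Transfer

open Polynomial ComplexConjugate

variable {n : ℕ}

/-- The numerator of the transfer function: `G = N / χ`, with `χ` the characteristic polynomial. -/
noncomputable def transferNum (A : Matrix (Fin n) (Fin n) ℂ) (b : Fin n → ℂ) : Fin n → ℂ[X] :=
  A.charmatrix.adjugate *ᵥ fun i => C (b i)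

theorem eval_charpoly_smul (A : Matrix (Fin n) (Fin n) ℂ) (b : Fin n → ℂ) (z : ℂ) :
    (z • (1 : Matrix (Fin n) (Fin n) ℂ) - A) *ᵥ (fun i => (transferNum A b i).eval z)
      = A.charpoly.eval z • b := by
  have h : A.charmatrix *ᵥ transferNum A b = A.charpoly • fun i => C (b i) := by
    rw [transferNum, Matrix.mulVec_mulVec, Matrix.mul_adjugate, Matrix.smul_mulVec,
      Matrix.one_mulVec]
    rfl
  ext i
  have hi := congrArg (eval z) (congrFun h i)
  simp only [Matrix.mulVec, dotProduct, eval_finsetSum, eval_mul, Pi.smul_apply, smul_eq_mul,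
    eval_C] at hi ⊢
  rw [← hi]
  refine Finset.sum_congr rfl fun j _ => ?_
  congr 1
  rcases eq_or_ne i j with rfl | hij
  · simp
  · simp [hij]

/-- The adjugate, viewed as a polynomial Q with matrix coefficients, satisfies (X − A)Q = χ·1. The
right side is monic of degree n and X − A is monic of degree 1, so Q has degree n − 1. -/
theorem natDegree_transferNum_lt (hn : 0 < n) (A : Matrix (Fin n) (Fin n) ℂ) (b : Fin n → ℂ)
    (i : Fin n) : (transferNum A b i).natDegree < n := by
  have : Nonempty (Fin n) := ⟨⟨0, hn⟩⟩
  set Q := matPolyEquiv A.charmatrix.adjugate with hQ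
  have h1 : (X - C A) * Q = A.charpoly.map (algebraMap ℂ (Matrix (Fin n) (Fin n) ℂ)) := by
    rw [← Matrix.matPolyEquiv_charmatrix, hQ, ← map_mul, Matrix.mul_adjugate,
      ← matPolyEquiv_smul_one]
    rfl
  have hm : (A.charpoly.map (algebraMap ℂ (Matrix (Fin n) (Fin n) ℂ))).Monic :=
    A.charpoly_monic.map _
  have hQ0 : Q ≠ 0 := by
    intro h
    rw [h, mul_zero] at h1
    exact hm.ne_zero h1.symm
  have h2 := (monic_X_sub_C A).natDegree_mul' hQ0
  rw [h1, A.charpoly_monic.natDegree_map, Matrix.charpoly_natDegree_eq_dim, natDegree_X_sub_C,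
    Fintype.card_fin] at h2
  have h3 : ∀ i j, (A.charmatrix.adjugate i j).natDegree ≤ n - 1 := fun i j => by
    rw [natDegree_le_iff_coeff_eq_zero]
    intro N hN
    rw [← matPolyEquiv_coeff_apply, ← hQ, coeff_eq_zero_of_natDegree_lt (by omega)]
    rfl
  have h4 : (transferNum A b i).natDegree ≤ n - 1 := by
    change (∑ j, A.charmatrix.adjugate i j * C (b j)).natDegree ≤ n - 1
    refine natDegree_sum_le_of_forall_le _ _ fun j _ => ?_
    exact (natDegree_mul_C_le _ _).trans (h3 i j)
  omega

theorem charpoly_eval_ne_zero {A : Matrix (Fin n) (Fin n) ℂ} (hA : IsStability A) {z : ℂ}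
    (hz : ‖z‖ = 1) : A.charpoly.eval z ≠ 0 := by
  intro h
  have := hA z (by rw [Matrix.mem_spectrum_iff_isRoot_charpoly]; exact h)
  exact this.ne hz

theorem transfer_eq_div {A : Matrix (Fin n) (Fin n) ℂ} (b : Fin n → ℂ) {z : ℂ}
    (hz : A.charpoly.eval z ≠ 0) (i : Fin n) :
    transfer A b z i = (transferNum A b i).eval z / A.charpoly.eval z := by
  have hdet : IsUnit (z • (1 : Matrix (Fin n) (Fin n) ℂ) - A).det := by
    rw [Matrix.eval_charpoly] at hz
    rw [isUnit_iff_ne_zero, Matrix.smul_one_eq_diagonal]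
    exact hz
  have h := eval_charpoly_smul A b z
  have h1 : (fun i => (transferNum A b i).eval z) = A.charpoly.eval z • transfer A b z := by
    rw [transfer, ← Matrix.mulVec_smul, ← h, Matrix.mulVec_mulVec, Matrix.nonsing_inv_mul _ hdet,
      Matrix.one_mulVec]
  rw [eq_div_iff hz, mul_comm]
  exact (congrFun h1 i).symm

/-- Pairing (zI − A)N = χb with a, where a·N = 0, gives (aA)·N = −(a·b)χ. The left side has degree
below n and χ has degree n, so both sides vanish. The relation passes to aA and can be iterated. -/
theorem sum_transferNum_eq_zero (hn : 0 < n) {A : Matrix (Fin n) (Fin n) ℂ} {b : Fin n → ℂ}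
    {a : Fin n → ℂ} (ha : ∑ i, C (a i) * transferNum A b i = 0) :
    a ⬝ᵥ b = 0 ∧ ∑ i, C ((a ᵥ* A) i) * transferNum A b i = 0 := by
  have hdeg : ∀ c : Fin n → ℂ, (∑ i, C (c i) * transferNum A b i).natDegree < n := fun c => by
    have : (∑ i, C (c i) * transferNum A b i).natDegree ≤ n - 1 := by
      refine natDegree_sum_le_of_forall_le _ _ fun i _ => (natDegree_C_mul_le _ _).trans ?_
      have := natDegree_transferNum_lt hn A b i
      omega
    omega
  have hev : ∀ (c : Fin n → ℂ) (z : ℂ), (∑ i, C (c i) * transferNum A b i).eval z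
      = c ⬝ᵥ fun i => (transferNum A b i).eval z := fun c z => by
    simp [eval_finsetSum, dotProduct]
  have key : ∑ i, C ((a ᵥ* A) i) * transferNum A b i = C (-(a ⬝ᵥ b)) * A.charpoly := by
    refine Polynomial.funext fun z => ?_
    have h0 := hev a z
    rw [ha, eval_zero] at h0
    have h := congrArg (fun v => a ⬝ᵥ v) (eval_charpoly_smul A b z)
    simp only [Matrix.sub_mulVec, Matrix.smul_mulVec, Matrix.one_mulVec, dotProduct_sub,
      dotProduct_smul, ← h0, smul_eq_mul] at h
    rw [hev, ← Matrix.dotProduct_mulVec, eval_mul, eval_C]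
    linear_combination -h
  have hab : a ⬝ᵥ b = 0 := by
    by_contra hne
    have h1 := hdeg (a ᵥ* A)
    rw [key, natDegree_C_mul (neg_ne_zero.2 hne), Matrix.charpoly_natDegree_eq_dim,
      Fintype.card_fin] at h1
    exact lt_irrefl _ h1
  exact ⟨hab, by rw [key, hab]; simp⟩

/-- Reachability makes the numerators linearly independent. -/
theorem eq_zero_of_sum_transferNum_eq_zero (hn : 0 < n) {A : Matrix (Fin n) (Fin n) ℂ}
    {b : Fin n → ℂ} (hAb : IsReachable A b) {a : Fin n → ℂ}
    (ha : ∑ i, C (a i) * transferNum A b i = 0) : a = 0 := by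
  have h1 : ∀ k : ℕ, ∑ i, C ((a ᵥ* A ^ k) i) * transferNum A b i = 0 := fun k => by
    induction k with
    | zero => simpa using ha
    | succ k ih =>
      have := (sum_transferNum_eq_zero hn ih).2
      rwa [Matrix.vecMul_vecMul, ← pow_succ] at this
  have h2 : ∀ v : Fin n → ℂ, a ⬝ᵥ v = 0 := fun v => by
    have hv : v ∈ Submodule.span ℂ (Set.range fun k : Fin n => (A ^ (k : ℕ)) *ᵥ b) := by
      rw [show Submodule.span ℂ _ = ⊤ from hAb]; trivial
    induction hv using Submodule.span_induction with
    | mem v hv =>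
      obtain ⟨k, rfl⟩ := hv
      simp only [Matrix.dotProduct_mulVec]
      exact (sum_transferNum_eq_zero hn (h1 k)).1
    | zero => simp
    | add v w _ _ hv hw => rw [dotProduct_add, hv, hw, add_zero]
    | smul c v _ hv => rw [dotProduct_smul, hv, smul_zero]
  ext i
  simpa using h2 (Pi.single i 1)

/-- A dimension count: n independent numerators lie in the n-dimensional space of polynomials of
degree below n. -/
theorem exists_eq_sum_transferNum (hn : 0 < n) {A : Matrix (Fin n) (Fin n) ℂ} {b : Fin n → ℂ}
    (hAb : IsReachable A b) {p : ℂ[X]} (hp : p.natDegree < n) :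
    ∃ a : Fin n → ℂ, p = ∑ i, C (a i) * transferNum A b i := by
  have hmem : ∀ q : ℂ[X], q.natDegree < n → q ∈ degreeLT ℂ n := fun q hq =>
    mem_degreeLT.2 (lt_of_le_of_lt degree_le_natDegree (by exact_mod_cast hq))
  let φ : (Fin n → ℂ) →ₗ[ℂ] degreeLT ℂ n :=
    Fintype.linearCombination ℂ
      (fun i => (⟨_, hmem _ (natDegree_transferNum_lt hn A b i)⟩ : degreeLT ℂ n))
  have hφ : ∀ a, ((φ a : degreeLT ℂ n) : ℂ[X]) = ∑ i, C (a i) * transferNum A b i := fun a => by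
    simp [φ, Fintype.linearCombination_apply, smul_eq_C_mul]
  have hinj : Function.Injective φ := by
    refine (injective_iff_map_eq_zero φ).2 fun a ha => ?_
    refine eq_zero_of_sum_transferNum_eq_zero hn hAb (a := a) ?_
    rw [← hφ, ha]; rfl
  have : FiniteDimensional ℂ (degreeLT ℂ n) := (degreeLTEquiv ℂ n).symm.finiteDimensional
  have hsurj := (LinearMap.injective_iff_surjective_of_finrank_eq_finrank
    (LinearEquiv.finrank_eq (degreeLTEquiv ℂ n)).symm).1 hinj
  obtain ⟨a, ha⟩ := hsurj ⟨p, hmem p hp⟩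
  exact ⟨a, by rw [← hφ, ha]⟩

/-- The real quadratic form `Re (v^* Λ v)`. -/
noncomputable def quadForm (Λ : Matrix (Fin n) (Fin n) ℂ) (v : Fin n → ℂ) : ℝ :=
  (∑ i, ∑ j, Λ i j * (v j * conj (v i))).re

theorem quadForm_smul (Λ : Matrix (Fin n) (Fin n) ℂ) (c : ℂ) (v : Fin n → ℂ) :
    quadForm Λ (c • v) = ‖c‖ ^ 2 * quadForm Λ v := by
  have : ∑ i, ∑ j, Λ i j * ((c • v) j * conj ((c • v) i))
      = ((‖c‖ ^ 2 : ℝ) : ℂ) * ∑ i, ∑ j, Λ i j * (v j * conj (v i)) := by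
    rw [← Complex.normSq_eq_norm_sq, ← Complex.mul_conj]
    simp only [Finset.mul_sum, Pi.smul_apply, smul_eq_mul, map_mul]
    refine Finset.sum_congr rfl fun i _ => Finset.sum_congr rfl fun j _ => ?_
    ring
  rw [quadForm, this, Complex.re_ofReal_mul, quadForm]

/-- Passing to the Hermitian part of Λ removes the real part, as needed to write the form as a
polynomial in z. -/
theorem ofReal_quadForm (Λ : Matrix (Fin n) (Fin n) ℂ) (v : Fin n → ℂ) :
    (quadForm Λ v : ℂ)
      = ∑ i, ∑ j, ((Λ i j + conj (Λ j i)) / 2) * (v j * conj (v i)) := by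
  rw [quadForm, Complex.re_eq_add_conj]
  simp only [map_sum, map_mul, Complex.conj_conj]
  rw [Finset.sum_comm (f := fun i j => conj (Λ i j) * _), ← Finset.sum_add_distrib,
    Finset.sum_div]
  refine Finset.sum_congr rfl fun i _ => ?_
  rw [← Finset.sum_add_distrib, Finset.sum_div]
  refine Finset.sum_congr rfl fun j _ => ?_
  ring

/-- If `Re (G^* Λ G)` is nonnegative on the circle, it is the squared modulus of a linear
combination of the components of `G`. -/
theorem exists_quadForm_transfer_eq_norm_sq (hn : 0 < n) {A : Matrix (Fin n) (Fin n) ℂ}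
    {b : Fin n → ℂ} (hA : IsStability A) (hAb : IsReachable A b)
    {Λ : Matrix (Fin n) (Fin n) ℂ} (h : ∀ z : ℂ, ‖z‖ = 1 → 0 ≤ quadForm Λ (transfer A b z)) :
    ∃ a : Fin n → ℂ, ∀ z : ℂ, ‖z‖ = 1 →
      quadForm Λ (transfer A b z) = ‖a ⬝ᵥ transfer A b z‖ ^ 2 := by
  set N := transferNum A b with hN
  have hNd : ∀ i, (N i).natDegree ≤ n - 1 := fun i => by
    rw [hN]
    have := natDegree_transferNum_lt hn A b i
    omega
  have hNG : ∀ z : ℂ, ‖z‖ = 1 →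
      (fun i => (N i).eval z) = A.charpoly.eval z • transfer A b z := fun z hz => by
    have hχ := charpoly_eval_ne_zero hA hz
    ext i
    simp [transfer_eq_div b hχ, hN]
    field_simp
  -- Chosen so that P(z) z̄^(n−1) = |χ(z)|² Re(G^*ΛG) on the circle.
  set P : ℂ[X] := ∑ i, ∑ j, C ((Λ i j + conj (Λ j i)) / 2) *
    (N j * reflect (n - 1) ((N i).map (starRingEnd ℂ))) with hP
  have hPd : P.natDegree ≤ 2 * (n - 1) := by
    refine natDegree_sum_le_of_forall_le _ _ fun i _ =>
      natDegree_sum_le_of_forall_le _ _ fun j _ => (natDegree_C_mul_le _ _).trans ?_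
    refine natDegree_mul_le.trans ?_
    have h1 := hNd j
    have h2 : (reflect (n - 1) ((N i).map (starRingEnd ℂ))).natDegree ≤ n - 1 :=
      natDegree_reflect_le.trans (max_le le_rfl (natDegree_map_le.trans (hNd i)))
    omega
  have hPe : ∀ z : ℂ, ‖z‖ = 1 → P.eval z * conj z ^ (n - 1)
      = ((‖A.charpoly.eval z‖ ^ 2 * quadForm Λ (transfer A b z) : ℝ) : ℂ) := fun z hz => by
    rw [← quadForm_smul, ← hNG z hz, ofReal_quadForm, hP]
    simp only [eval_finsetSum, eval_mul, eval_C, Finset.sum_mul]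
    refine Finset.sum_congr rfl fun i _ => Finset.sum_congr rfl fun j _ => ?_
    rw [eval_reflect_map_conj (hNd i) (ne_zero_of_norm_one hz), conj_inv_of_norm_one hz]
    have h2 : z ^ (n - 1) * conj z ^ (n - 1) = 1 := by
      rw [← mul_pow, mul_conj_of_norm_one hz, one_pow]
    linear_combination ((Λ i j + conj (Λ j i)) / 2 * eval z (N j) * conj (eval z (N i))) * h2
  obtain ⟨p, hp, hpe⟩ := fejerRiesz hPd fun z hz => by
    rw [hPe z hz]
    have := h z hz
    exact_mod_cast (by positivity : 0 ≤ ‖A.charpoly.eval z‖ ^ 2 * quadForm Λ (transfer A b z))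
  -- The Fejér–Riesz factor has degree at most n − 1, so it is a combination of the numerators;
  -- division by χ turns it into a·G.
  obtain ⟨a, rfl⟩ := exists_eq_sum_transferNum hn hAb (p := p) (by omega)
  refine ⟨a, fun z hz => ?_⟩
  have h1 := (hPe z hz).symm.trans (hpe z hz)
  have h2 : (∑ i, C (a i) * transferNum A b i).eval z
      = A.charpoly.eval z * (a ⬝ᵥ transfer A b z) := by
    rw [← smul_eq_mul, ← dotProduct_smul, ← hNG z hz]
    simp [eval_finsetSum, dotProduct, hN]
  rw [h2, norm_mul, mul_pow] at h1
  have h3 : 0 < ‖A.charpoly.eval z‖ ^ 2 :=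
    pow_pos (norm_pos_iff.2 (charpoly_eval_ne_zero hA hz)) 2
  exact mul_left_cancel₀ h3.ne' (by exact_mod_cast h1)

end Transfer

/-! ### Integrals against a bounded coercive weight, and a lower bound for Lipschitz functions. -/

instance : IsProbabilityMeasure circleMeasure :=
  inferInstanceAs (IsProbabilityMeasure (AddCircle.haarAddCircle (T := 2 * Real.pi)))

instance : circleMeasure.IsOpenPosMeasure :=
  inferInstanceAs ((AddCircle.haarAddCircle (T := 2 * Real.pi)).IsOpenPosMeasure)

section Weight

/-- A bounded, coercive weight on the circle. -/
structure IsWeight (ψ : Torus → ℝ) (c M : ℝ) : Prop where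
  meas : AEStronglyMeasurable ψ circleMeasure
  c_pos : 0 < c
  lower : ∀ᵐ θ ∂circleMeasure, c ≤ ψ θ
  upper : ∀ᵐ θ ∂circleMeasure, ψ θ ≤ M

variable {ψ : Torus → ℝ} {c M : ℝ}

theorem IsWeight.le (h : IsWeight ψ c M) : c ≤ M := by
  obtain ⟨θ, h1, h2⟩ := (h.lower.and h.upper).exists
  exact h1.trans h2

theorem IsWeight.nonneg (h : IsWeight ψ c M) : ∀ᵐ θ ∂circleMeasure, 0 ≤ ψ θ :=
  h.lower.mono fun _ hθ => h.c_pos.le.trans hθ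

theorem IsWeight.integrable (h : IsWeight ψ c M) : Integrable ψ circleMeasure := by
  refine Integrable.of_bound h.meas M ?_
  filter_upwards [h.nonneg, h.upper] with θ h1 h2
  rwa [Real.norm_eq_abs, abs_of_nonneg h1]

theorem integrable_circle_of_continuous {g : Torus → ℝ} (hg : Continuous g) :
    Integrable g circleMeasure := by
  obtain ⟨D, hD⟩ := isCompact_univ.exists_bound_of_continuousOn hg.continuousOn
  exact Integrable.of_bound hg.aestronglyMeasurable D (Eventually.of_forall fun θ => hD θ trivial)

theorem IsWeight.integrable_mul (h : IsWeight ψ c M) {g : Torus → ℝ} (hg : Continuous g) :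
    Integrable (fun θ => ψ θ * g θ) circleMeasure := by
  obtain ⟨D, hD⟩ := isCompact_univ.exists_bound_of_continuousOn hg.continuousOn
  exact h.integrable.mul_bdd hg.aestronglyMeasurable (Eventually.of_forall fun θ => hD θ trivial)

theorem IsWeight.integral_mul_mono (h : IsWeight ψ c M) {f g : Torus → ℝ} (hf : Continuous f)
    (hg : Continuous g) (hfg : ∀ θ, f θ ≤ g θ) :
    ∫ θ, ψ θ * f θ ∂circleMeasure ≤ ∫ θ, ψ θ * g θ ∂circleMeasure := by
  refine integral_mono_ae (h.integrable_mul hf) (h.integrable_mul hg) ?_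
  filter_upwards [h.nonneg] with θ hθ
  exact mul_le_mul_of_nonneg_left (hfg θ) hθ

theorem IsWeight.integral_mul_nonneg (h : IsWeight ψ c M) {f : Torus → ℝ}
    (hf : ∀ θ, 0 ≤ f θ) : 0 ≤ ∫ θ, ψ θ * f θ ∂circleMeasure := by
  refine integral_nonneg_of_ae ?_
  filter_upwards [h.nonneg] with θ hθ
  exact mul_nonneg hθ (hf θ)

theorem IsWeight.mul_integral_le (h : IsWeight ψ c M) {f : Torus → ℝ} (hf : Continuous f)
    (hf0 : ∀ θ, 0 ≤ f θ) :
    c * ∫ θ, f θ ∂circleMeasure ≤ ∫ θ, ψ θ * f θ ∂circleMeasure := by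
  rw [← integral_const_mul]
  refine integral_mono_ae ((integrable_circle_of_continuous hf).const_mul c) (h.integrable_mul hf) ?_
  filter_upwards [h.lower] with θ hθ
  exact mul_le_mul_of_nonneg_right hθ (hf0 θ)

theorem IsWeight.integral_le (h : IsWeight ψ c M) : ∫ θ, ψ θ ∂circleMeasure ≤ M := by
  have := integral_mono_ae h.integrable (integrable_const M) h.upper
  simpa using this

end Weight

/-- A positive Lipschitz function on the circle whose reciprocal has a bounded integral is bounded
below. -/
theorem lower_bound_of_integral_inv_le {q : Torus → ℝ} (hq : Continuous q) {K B : ℝ} (hK : 0 < K)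
    (hLip : ∀ s t : ℝ, |q s - q t| ≤ K * |s - t|) (hpos : ∀ θ, 0 < q θ)
    (hB : ∫ θ, (q θ)⁻¹ ∂circleMeasure ≤ B) (θ : Torus) :
    2 * Real.pi * K * Real.exp (-(2 * Real.pi * K * B)) ≤ q θ := by
  induction θ using QuotientAddGroup.induction_on with | H t₀ => ?_
  set a := q (t₀ : Torus) with ha
  have ha0 : 0 < a := hpos _
  have hπ := Real.two_pi_pos
  have hint : ∫ θ, (q θ)⁻¹ ∂circleMeasure
      = (2 * Real.pi)⁻¹ * ∫ t in t₀..t₀ + 2 * Real.pi, (q (t : Torus))⁻¹ := by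
    rw [circleMeasure, AddCircle.integral_haarAddCircle,
      AddCircle.intervalIntegral_preimage (2 * Real.pi) t₀ (fun θ => (q θ)⁻¹), smul_eq_mul]
  -- Over one period q(t) ≤ a + K(t − t₀), so the mean of 1/q is at least log((a + 2πK)/a)/(2πK),
  -- which is large when a is small.
  have hpos' : ∀ t ∈ Set.Icc t₀ (t₀ + 2 * Real.pi), 0 < a + K * (t - t₀) := fun t ht => by
    have := mul_nonneg hK.le (sub_nonneg.2 ht.1)
    linarith
  have hle : t₀ ≤ t₀ + 2 * Real.pi := by linarith
  have hcont : ContinuousOn (fun t => (a + K * (t - t₀))⁻¹) (Set.uIcc t₀ (t₀ + 2 * Real.pi)) := by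
    rw [Set.uIcc_of_le hle]
    exact ContinuousOn.inv₀ (by fun_prop) fun t ht => (hpos' t ht).ne'
  have hcontq : Continuous fun t : ℝ => (q (t : Torus))⁻¹ :=
    (hq.comp (AddCircle.continuous_mk' _)).inv₀ fun t => (hpos _).ne'
  have h1 : ∫ t in t₀..t₀ + 2 * Real.pi, (a + K * (t - t₀))⁻¹
      ≤ ∫ t in t₀..t₀ + 2 * Real.pi, (q (t : Torus))⁻¹ := by
    refine intervalIntegral.integral_mono_on hle hcont.intervalIntegrable
      (hcontq.intervalIntegrable _ _) fun t ht => ?_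
    refine inv_anti₀ (hpos _) ?_
    have := (le_abs_self _).trans (hLip t t₀)
    rw [abs_of_nonneg (sub_nonneg.2 ht.1)] at this
    linarith
  have h2 : ∫ t in t₀..t₀ + 2 * Real.pi, (a + K * (t - t₀))⁻¹
      = K⁻¹ * Real.log (a + K * (2 * Real.pi)) - K⁻¹ * Real.log a := by
    have hd : ∀ t ∈ Set.uIcc t₀ (t₀ + 2 * Real.pi),
        HasDerivAt (fun t => K⁻¹ * Real.log (a + K * (t - t₀))) ((a + K * (t - t₀))⁻¹) t := by
      intro t ht
      rw [Set.uIcc_of_le hle] at ht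
      have h3 : HasDerivAt (fun t => a + K * (t - t₀)) K t := by
        simpa using (((hasDerivAt_id t).sub_const t₀).const_mul K).const_add a
      have h4 := (h3.log (hpos' t ht).ne').const_mul K⁻¹
      rw [div_eq_mul_inv, inv_mul_cancel_left₀ hK.ne'] at h4
      exact h4
    rw [intervalIntegral.integral_eq_sub_of_hasDerivAt hd hcont.intervalIntegrable]
    simp
  have h3 : Real.log (2 * Real.pi * K) - Real.log a ≤ 2 * Real.pi * K * B := by
    have h4 : Real.log (2 * Real.pi * K) ≤ Real.log (a + K * (2 * Real.pi)) :=
      Real.log_le_log (by positivity) (by linarith)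
    have h5 : (2 * Real.pi)⁻¹ * (K⁻¹ * Real.log (a + K * (2 * Real.pi)) - K⁻¹ * Real.log a) ≤ B := by
      rw [← h2]
      refine le_trans ?_ (hint ▸ hB)
      exact mul_le_mul_of_nonneg_left h1 (by positivity)
    have h6 : Real.log (a + K * (2 * Real.pi)) - Real.log a
        = 2 * Real.pi * K *
          ((2 * Real.pi)⁻¹ * (K⁻¹ * Real.log (a + K * (2 * Real.pi)) - K⁻¹ * Real.log a)) := by
      field_simp
    have h7 := mul_le_mul_of_nonneg_left h5 (by positivity : 0 ≤ 2 * Real.pi * K)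
    linarith
  rw [← Real.log_le_log_iff (by positivity) ha0, Real.log_mul (by positivity) (by positivity),
    Real.log_exp]
  linarith

/-! ### The dual problem: existence and stability of stationary points. -/

section Dual

variable {ψ : Torus → ℝ} {c M : ℝ} {E : Type*} [NormedAddCommGroup E]
  [NormedSpace ℝ E] {ev : E →ₗ[ℝ] C(Torus, ℝ)} {K : ℝ}

/-- `ev` parametrizes a space of functions on the circle that are Lipschitz in the angle. -/
structure IsLipschitzFamily (ev : E →ₗ[ℝ] C(Torus, ℝ)) (K : ℝ) : Prop where
  K_pos : 0 < K
  injective : Function.Injective ev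
  abs_le : ∀ x θ, |ev x θ| ≤ K * ‖x‖
  lipschitz : ∀ x, ∀ s t : ℝ, |ev x (s : Torus) - ev x (t : Torus)| ≤ K * ‖x‖ * |s - t|

/-- `L` is positive on the nonzero parameters of nonnegative functions. -/
def IsPositive (ev : E →ₗ[ℝ] C(Torus, ℝ)) (L : E →L[ℝ] ℝ) : Prop :=
  ∀ q : E, (∀ θ, 0 ≤ ev q θ) → q ≠ 0 → 0 < L q

/-- `ev q` is positive and satisfies the stationarity condition of the dual problem for `L`. -/
def IsStationary (ψ : Torus → ℝ) (ev : E →ₗ[ℝ] C(Torus, ℝ)) (L : E →L[ℝ] ℝ) (q : E) : Prop :=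
  (∀ θ, 0 < ev q θ) ∧ ∀ p : E, L p = ∫ θ, ψ θ * (ev p θ / ev q θ) ∂circleMeasure

/-- The dual functional `q ↦ L q - ∫ ψ log q`. -/
noncomputable def dualFunctional (ψ : Torus → ℝ) (ev : E →ₗ[ℝ] C(Torus, ℝ)) (L : E →L[ℝ] ℝ)
    (q : E) : ℝ :=
  L q - ∫ θ, ψ θ * Real.log (ev q θ) ∂circleMeasure

theorem exists_pos_le_of_pos {q : C(Torus, ℝ)} (hq : ∀ θ, 0 < q θ) :
    ∃ m, 0 < m ∧ ∀ θ, m ≤ q θ := by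
  obtain ⟨m, hm, h⟩ := isCompact_univ.exists_forall_le' q.continuous.continuousOn
    (fun θ _ => hq θ)
  exact ⟨m, hm, fun θ => h θ trivial⟩

theorem continuous_div_of_pos {p q : C(Torus, ℝ)} (hq : ∀ θ, 0 < q θ) :
    Continuous fun θ => p θ / q θ :=
  p.continuous.div q.continuous fun θ => (hq θ).ne'

theorem continuous_log_of_pos {q : C(Torus, ℝ)} (hq : ∀ θ, 0 < q θ) :
    Continuous fun θ => Real.log (q θ) :=
  q.continuous.log fun θ => (hq θ).ne'

/-- This is log s ≥ 1 − 1/s at s = (x + ty)/x. The condition t D ≤ m/2 keeps x + ty ≥ m/2, which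
makes the second-order remainder uniform. -/
theorem log_add_mul_ge {x y m D t : ℝ} (hm : 0 < m) (hx : m ≤ x) (hy : |y| ≤ D) (ht : 0 < t)
    (htD : t * D ≤ m / 2) :
    t * (y / x) - t ^ 2 * (2 * D ^ 2 / m ^ 2) ≤ Real.log (x + t * y) - Real.log x := by
  have hx0 : 0 < x := hm.trans_le hx
  have h1 : m / 2 ≤ x + t * y := by
    have := mul_le_mul_of_nonneg_left (neg_le_of_abs_le hy) ht.le
    linarith
  have h2 : 0 < x + t * y := by linarith
  have h3 := Real.one_sub_inv_le_log_of_pos (div_pos h2 hx0)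
  rw [Real.log_div h2.ne' hx0.ne'] at h3
  have h4 : t * (y / x) - (1 - ((x + t * y) / x)⁻¹) = t ^ 2 * (y ^ 2 / (x * (x + t * y))) := by
    field_simp
    ring
  have h5 : y ^ 2 / (x * (x + t * y)) ≤ D ^ 2 / (m * (m / 2)) := by
    refine div_le_div₀ (sq_nonneg D) ?_ (by positivity) ?_
    · rw [← sq_abs y]
      exact pow_le_pow_left₀ (abs_nonneg y) hy 2
    · exact mul_le_mul hx h1 (by linarith) hx0.le
  have h6 : D ^ 2 / (m * (m / 2)) = 2 * D ^ 2 / m ^ 2 := by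
    field_simp
  have h7 := mul_le_mul_of_nonneg_left (h5.trans_eq h6) (sq_nonneg t)
  linarith

/-- First-order condition at a minimum of the dual functional along a direction `p`. -/
theorem integral_div_le_of_forall_dualFunctional_le (hψ : IsWeight ψ c M)
    (hev : IsLipschitzFamily ev K) {L : E →L[ℝ] ℝ}
    {q p : E} (hq : ∀ θ, 0 < ev q θ) {ε : ℝ} (hε : 0 < ε)
    (h : ∀ t, 0 < t → t < ε → dualFunctional ψ ev L q ≤ dualFunctional ψ ev L (q + t • p)) :
    ∫ θ, ψ θ * (ev p θ / ev q θ) ∂circleMeasure ≤ L p := by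
  obtain ⟨m, hm, hmq⟩ := exists_pos_le_of_pos hq
  set D := K * ‖p‖ with hD
  have hD0 : 0 ≤ D := mul_nonneg hev.K_pos.le (norm_nonneg p)
  set C := ∫ θ, ψ θ * (2 * D ^ 2 / m ^ 2) ∂circleMeasure with hC
  set I := ∫ θ, ψ θ * (ev p θ / ev q θ) ∂circleMeasure with hI
  -- The second bound on t gives t D ≤ m/2, so q + tp stays positive. The error t²C becomes tC after
  -- division by t and disappears as t → 0+.
  have key : ∀ t, 0 < t → t < min ε (m / (2 * (D + 1))) → I - t * C ≤ L p := by
    intro t ht0 ht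
    have htD : t * D ≤ m / 2 := by
      have h1 := (lt_min_iff.1 ht).2
      rw [lt_div_iff₀ (by positivity)] at h1
      nlinarith
    have hpos : ∀ θ, 0 < ev (q + t • p) θ := fun θ => by
      have h1 := mul_le_mul_of_nonneg_left (neg_le_of_abs_le (hev.abs_le p θ)) ht0.le
      have h2 : ev (q + t • p) θ = ev q θ + t * ev p θ := by simp
      have h3 := hmq θ
      rw [h2]
      linarith
    have h1 := h t ht0 (lt_min_iff.1 ht).1
    have hi1 := hψ.integrable_mul (continuous_log_of_pos hpos)
    have hi2 := hψ.integrable_mul (continuous_log_of_pos hq)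
    have hi3 := hψ.integrable_mul (continuous_div_of_pos (p := ev p) hq)
    have hi4 := hψ.integrable_mul (continuous_const (y := 2 * D ^ 2 / m ^ 2))
    have h2 : t * I - t ^ 2 * C ≤ ∫ θ, ψ θ * Real.log (ev (q + t • p) θ) ∂circleMeasure
        - ∫ θ, ψ θ * Real.log (ev q θ) ∂circleMeasure := by
      rw [hI, hC, ← integral_const_mul, ← integral_const_mul,
        ← integral_sub (hi3.const_mul t) (hi4.const_mul _), ← integral_sub hi1 hi2]
      refine integral_mono_ae ((hi3.const_mul t).sub (hi4.const_mul _)) (hi1.sub hi2) ?_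
      filter_upwards [hψ.nonneg] with θ hθ
      have h3 := mul_le_mul_of_nonneg_left
        (log_add_mul_ge hm (hmq θ) (hev.abs_le p θ) ht0 htD) hθ
      have h4 : ev (q + t • p) θ = ev q θ + t * ev p θ := by simp
      rw [h4]
      linarith
    rw [dualFunctional, dualFunctional, map_add, map_smul, smul_eq_mul] at h1
    have h5 : t * (I - t * C) ≤ t * L p := by linarith
    exact le_of_mul_le_mul_left h5 ht0
  have hlim : Tendsto (fun t => I - t * C) (𝓝[>] 0) (𝓝 I) := by
    have : ContinuousAt (fun t => I - t * C) 0 := by fun_prop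
    have h1 := this.tendsto
    simp only [zero_mul, sub_zero] at h1
    exact h1.mono_left nhdsWithin_le_nhds
  have hpos : 0 < min ε (m / (2 * (D + 1))) :=
    lt_min hε (div_pos hm (by positivity))
  refine le_of_tendsto hlim ?_
  filter_upwards [Ioo_mem_nhdsGT hpos] with t ht
  exact key t ht.1 ht.2

/-- Since ψ ≥ c and q₀ is bounded below, the hypothesis bounds ∫1/q, and the Lipschitz estimate
applies. The bound m is uniform in q, which keeps dual minimizers off the boundary of the cone. -/
theorem exists_lower_bound (hψ : IsWeight ψ c M) (hev : IsLipschitzFamily ev K) {q₀ : E}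
    (hq₀ : ∀ θ, 0 < ev q₀ θ) (R B : ℝ) :
    ∃ m, 0 < m ∧ ∀ q : E, (∀ θ, 0 < ev q θ) → ‖q‖ ≤ R →
      ∫ θ, ψ θ * (ev q₀ θ / ev q θ) ∂circleMeasure ≤ B → ∀ θ, m ≤ ev q θ := by
  have hK := hev.K_pos
  obtain ⟨m₀, hm₀, hmq⟩ := exists_pos_le_of_pos hq₀
  have hcm : 0 < c * m₀ := mul_pos hψ.c_pos hm₀
  have hR : 0 < |R| + 1 := by positivity
  have hKR : 0 < K * (|R| + 1) := mul_pos hK hR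
  refine ⟨2 * Real.pi * (K * (|R| + 1)) *
    Real.exp (-(2 * Real.pi * (K * (|R| + 1)) * (B / (c * m₀)))), ?_, fun q hq hqR hB => ?_⟩
  · have := Real.two_pi_pos
    positivity
  refine lower_bound_of_integral_inv_le (ev q).continuous hKR (fun s t => ?_) hq ?_
  · refine (hev.lipschitz q s t).trans (mul_le_mul_of_nonneg_right ?_ (abs_nonneg _))
    refine mul_le_mul_of_nonneg_left ?_ hK.le
    linarith [le_abs_self R]
  · have hci : Continuous fun θ => (ev q θ)⁻¹ := (ev q).continuous.inv₀ fun θ => (hq θ).ne'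
    rw [le_div_iff₀ hcm]
    refine le_trans ?_ hB
    have h1 := hψ.mul_integral_le (f := fun θ => m₀ * (ev q θ)⁻¹) (hci.const_mul m₀)
      (fun θ => mul_nonneg hm₀.le (inv_nonneg.2 (hq θ).le))
    rw [integral_const_mul] at h1
    have h2 := hψ.integral_mul_mono (hci.const_mul m₀) (continuous_div_of_pos (p := ev q₀) hq)
      (fun θ => by
        rw [div_eq_mul_inv]
        exact mul_le_mul_of_nonneg_right (hmq θ) (inv_nonneg.2 (hq θ).le))
    linarith

theorem IsStationary.apply_self {L : E →L[ℝ] ℝ} {q : E} (h : IsStationary ψ ev L q) :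
    L q = ∫ θ, ψ θ ∂circleMeasure := by
  rw [h.2 q]
  refine integral_congr_ae (Eventually.of_forall fun θ => ?_)
  change ψ θ * (ev q θ / ev q θ) = ψ θ
  rw [div_self (h.1 θ).ne', mul_one]

variable [FiniteDimensional ℝ E]

theorem continuous_family_apply (θ : Torus) : Continuous fun q => ev q θ :=
  ((LinearMap.proj θ).comp
    ((ContinuousMap.coeFnLinearMap ℝ).comp ev)).continuous_of_finiteDimensional

/-- By homogeneity it suffices to minimize L over the unit sphere intersected with the closed cone,
which is compact. -/
theorem IsPositive.exists_mul_norm_le {L : E →L[ℝ] ℝ} (hL : IsPositive ev L) :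
    ∃ δ, 0 < δ ∧ ∀ q : E, (∀ θ, 0 ≤ ev q θ) → δ * ‖q‖ ≤ L q := by
  have : ProperSpace E := FiniteDimensional.proper ℝ E
  have hcl : IsClosed {q : E | ∀ θ, 0 ≤ ev q θ} := by
    simp only [Set.ofPred_forall]
    exact isClosed_iInter fun θ => isClosed_le continuous_const
      (continuous_family_apply θ)
  have hK : IsCompact (Metric.sphere (0 : E) 1 ∩ {q : E | ∀ θ, 0 ≤ ev q θ}) :=
    (isCompact_sphere _ _).inter_right hcl
  obtain ⟨δ, hδ, h⟩ := hK.exists_forall_le' L.continuous.continuousOn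
    (fun q hq => hL q hq.2 (ne_zero_of_mem_unit_sphere ⟨q, hq.1⟩))
  refine ⟨δ, hδ, fun q hq => ?_⟩
  rcases eq_or_ne q 0 with rfl | hq0
  · simp
  have hn : 0 < ‖q‖ := norm_pos_iff.2 hq0
  have h1 := h (‖q‖⁻¹ • q) ⟨by simp [norm_smul, hn.ne'], fun θ => by
    simpa using mul_nonneg (inv_nonneg.2 hn.le) (hq θ)⟩
  rw [map_smul, smul_eq_mul, le_inv_mul_iff₀ hn] at h1
  linarith

theorem exists_mul_norm_sq_le_integral_sq (hev : IsLipschitzFamily ev K) :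
    ∃ κ, 0 < κ ∧ ∀ q : E, κ * ‖q‖ ^ 2 ≤ ∫ θ, (ev q θ) ^ 2 ∂circleMeasure := by
  have : ProperSpace E := FiniteDimensional.proper ℝ E
  have hcont : Continuous fun q : E => ∫ θ, (ev q θ) ^ 2 ∂circleMeasure := by
    refine continuous_iff_continuousAt.2 fun q₀ => ?_
    refine continuousAt_of_dominated (bound := fun _ => (K * (‖q₀‖ + 1)) ^ 2)
      (Eventually.of_forall fun q => ((ev q).continuous.pow 2).aestronglyMeasurable) ?_
      (integrable_const _) (Eventually.of_forall fun θ => ?_)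
    · filter_upwards [Metric.ball_mem_nhds q₀ one_pos] with q hq
      refine Eventually.of_forall fun θ => ?_
      rw [Real.norm_eq_abs, abs_pow]
      refine pow_le_pow_left₀ (abs_nonneg _) ((hev.abs_le q θ).trans ?_) 2
      have h1 := norm_sub_norm_le q q₀
      rw [mem_ball_iff_norm] at hq
      refine mul_le_mul_of_nonneg_left ?_ hev.K_pos.le
      linarith
    · exact ((continuous_family_apply θ).pow 2).continuousAt
  obtain ⟨κ, hκ, h⟩ := (isCompact_sphere (0 : E) 1).exists_forall_le' hcont.continuousOn
    (a := 0) (fun q hq => by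
      have hq0 : q ≠ 0 := ne_zero_of_mem_unit_sphere ⟨q, hq⟩
      obtain ⟨θ, hθ⟩ : ∃ θ, ev q θ ≠ 0 := by
        by_contra! hcon
        exact hq0 (hev.injective (by rw [map_zero]; exact ContinuousMap.ext hcon))
      have hc2 : Continuous fun θ => (ev q θ) ^ 2 := (ev q).continuous.pow 2
      exact integral_pos_of_integrable_nonneg_nonzero hc2
        (integrable_circle_of_continuous hc2) (fun θ => sq_nonneg _) (pow_ne_zero 2 hθ))
  refine ⟨κ, hκ, fun q => ?_⟩
  rcases eq_or_ne q 0 with rfl | hq0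
  · simp
  have hn : 0 < ‖q‖ := norm_pos_iff.2 hq0
  have h1 := h (‖q‖⁻¹ • q) (by simp [norm_smul, hn.ne'])
  have h2 : ∫ θ, (ev (‖q‖⁻¹ • q) θ) ^ 2 ∂circleMeasure
      = (‖q‖ ^ 2)⁻¹ * ∫ θ, (ev q θ) ^ 2 ∂circleMeasure := by
    rw [← integral_const_mul]
    refine integral_congr_ae (Eventually.of_forall fun θ => ?_)
    simp only [map_smul, ContinuousMap.smul_apply, smul_eq_mul]
    rw [mul_pow, inv_pow]
  rw [h2, le_inv_mul_iff₀ (by positivity)] at h1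
  linarith

theorem continuousOn_dualFunctional (hψ : IsWeight ψ c M) (hev : IsLipschitzFamily ev K) (L : E →L[ℝ] ℝ) {m R : ℝ}
    (hm : 0 < m) :
    ContinuousOn (dualFunctional ψ ev L) {q : E | (∀ θ, m ≤ ev q θ) ∧ ‖q‖ ≤ R} := by
  refine L.continuous.continuousOn.sub ?_
  refine continuousOn_of_dominated (bound := fun θ => ψ θ * (|Real.log m| + |Real.log (K * R)|))
    (fun q hq => (hψ.integrable_mul
      (continuous_log_of_pos fun θ => hm.trans_le (hq.1 θ))).aestronglyMeasurable) (fun q hq => ?_)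
    (hψ.integrable.mul_const _) (Eventually.of_forall fun θ => ?_)
  · filter_upwards [hψ.nonneg] with θ hθ
    rw [norm_mul, Real.norm_eq_abs, abs_of_nonneg hθ, Real.norm_eq_abs]
    refine mul_le_mul_of_nonneg_left ?_ hθ
    have h0 : 0 < ev q θ := hm.trans_le (hq.1 θ)
    have h1 := Real.log_le_log hm (hq.1 θ)
    have h2 := Real.log_le_log h0 ((le_abs_self _).trans ((hev.abs_le q θ).trans
      (mul_le_mul_of_nonneg_left hq.2 hev.K_pos.le)))
    rw [abs_le]
    constructor
    · linarith [neg_abs_le (Real.log m), abs_nonneg (Real.log (K * R))]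
    · linarith [le_abs_self (Real.log (K * R)), abs_nonneg (Real.log m)]
  · refine continuousOn_const.mul (ContinuousOn.log ?_ fun q hq => (hm.trans_le (hq.1 θ)).ne')
    exact (continuous_family_apply θ).continuousOn

/-- The dual problem has an interior stationary point. -/
theorem exists_isStationary (hψ : IsWeight ψ c M) (hev : IsLipschitzFamily ev K) {q₀ : E}
    (hq₀ : ∀ θ, 0 < ev q₀ θ) {L : E →L[ℝ] ℝ} (hL : IsPositive ev L) :
    ∃ q : E, IsStationary ψ ev L q := by
  have : ProperSpace E := FiniteDimensional.proper ℝ E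
  obtain ⟨δ, hδ, hδL⟩ := hL.exists_mul_norm_le
  obtain ⟨m₀, hm₀, hmq₀⟩ := exists_pos_le_of_pos hq₀
  set B := L q₀ + M with hB
  obtain ⟨m₁, hm₁, hmB⟩ := exists_lower_bound hψ hev hq₀ (B / δ) B
  -- The a priori bounds B/δ and m₁ are fixed before the compact set {q ≥ m, ‖q‖ ≤ R}. A minimizer
  -- on it will satisfy both, hence lie strictly inside.
  set m := min m₀ (m₁ / 2) with hm
  have hm_pos : 0 < m := lt_min hm₀ (half_pos hm₁)
  set R := max ‖q₀‖ (B / δ + 1) with hR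
  set S : Set E := {q : E | (∀ θ, m ≤ ev q θ) ∧ ‖q‖ ≤ R} with hS
  have hSc : IsCompact S := by
    have hcl : IsClosed {q : E | ∀ θ, m ≤ ev q θ} := by
      simp only [Set.ofPred_forall]
      exact isClosed_iInter fun θ => isClosed_le continuous_const
        (continuous_family_apply θ)
    have h1 : S = Metric.closedBall 0 R ∩ {q : E | ∀ θ, m ≤ ev q θ} := by
      ext q
      simp [hS, and_comm]
    rw [h1]
    exact (isCompact_closedBall _ _).inter_right hcl
  have hq₀S : q₀ ∈ S := ⟨fun θ => (min_le_left _ _).trans (hmq₀ θ), le_max_left _ _⟩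
  obtain ⟨q, hqS, hqmin⟩ := hSc.exists_isMinOn ⟨q₀, hq₀S⟩
    (continuousOn_dualFunctional hψ hev L hm_pos)
  have hq : ∀ θ, 0 < ev q θ := fun θ => hm_pos.trans_le (hqS.1 θ)
  -- The compact set is convex and contains q₀, so this direction is admissible even if q were on
  -- its boundary. It yields L q + ∫ψq₀/q ≤ B.
  have h1 : ∫ θ, ψ θ * (ev (q₀ - q) θ / ev q θ) ∂circleMeasure ≤ L (q₀ - q) := by
    refine integral_div_le_of_forall_dualFunctional_le hψ hev hq one_pos fun t ht0 ht1 => ?_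
    refine hqmin ⟨fun θ => ?_, ?_⟩
    · have h2 : ev (q + t • (q₀ - q)) θ = (1 - t) * ev q θ + t * ev q₀ θ := by
        simp only [map_add, map_smul, map_sub, ContinuousMap.add_apply, ContinuousMap.smul_apply,
          ContinuousMap.sub_apply, smul_eq_mul]
        ring
      rw [h2]
      nlinarith [hqS.1 θ, hq₀S.1 θ]
    · have h2 : q + t • (q₀ - q) = (1 - t) • q + t • q₀ := by module
      rw [h2]
      refine (norm_add_le _ _).trans ?_
      rw [norm_smul, norm_smul, Real.norm_of_nonneg (by linarith), Real.norm_of_nonneg ht0.le]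
      nlinarith [hqS.2, hq₀S.2]
  have h2 : ∫ θ, ψ θ * (ev (q₀ - q) θ / ev q θ) ∂circleMeasure
      = ∫ θ, ψ θ * (ev q₀ θ / ev q θ) ∂circleMeasure - ∫ θ, ψ θ ∂circleMeasure := by
    rw [← integral_sub (hψ.integrable_mul (continuous_div_of_pos hq)) hψ.integrable]
    refine integral_congr_ae (Eventually.of_forall fun θ => ?_)
    simp only [map_sub, ContinuousMap.sub_apply]
    have := (hq θ).ne'
    field_simp
  have h3 : L q + ∫ θ, ψ θ * (ev q₀ θ / ev q θ) ∂circleMeasure ≤ B := by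
    rw [h2, map_sub] at h1
    linarith [hψ.integral_le]
  have h4 := hδL q fun θ => (hq θ).le
  have h5 := hψ.integral_mul_nonneg (f := fun θ => ev q₀ θ / ev q θ)
    fun θ => (div_pos (hq₀ θ) (hq θ)).le
  have h6 : ‖q‖ ≤ B / δ := by
    rw [le_div_iff₀ hδ]
    linarith
  have h7 : ∀ θ, m₁ ≤ ev q θ := hmB q hq h6 (by
    have : 0 ≤ δ * ‖q‖ := by positivity
    linarith)
  -- Now q is interior, so every direction is admissible: for t < ε the values move by at most m₁/2
  -- and the norm by at most 1. Using both p and −p gives equality.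
  have h8 : ∀ p : E, ∫ θ, ψ θ * (ev p θ / ev q θ) ∂circleMeasure ≤ L p := by
    intro p
    have hp : 0 < (K + 1) * (‖p‖ + 1) := by
      have := hev.K_pos
      positivity
    refine integral_div_le_of_forall_dualFunctional_le hψ hev hq
      (ε := min (m₁ / 2) 1 / ((K + 1) * (‖p‖ + 1))) (by positivity) fun t ht0 ht1 => ?_
    rw [lt_div_iff₀ hp, lt_min_iff] at ht1
    refine hqmin ⟨fun θ => ?_, ?_⟩
    · have h9 := mul_le_mul_of_nonneg_left (neg_le_of_abs_le (hev.abs_le p θ)) ht0.le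
      simp only [map_add, map_smul, ContinuousMap.add_apply, ContinuousMap.smul_apply, smul_eq_mul]
      have h10 := h7 θ
      have h11 : m ≤ m₁ / 2 := min_le_right _ _
      nlinarith [ht1.1, hev.K_pos, norm_nonneg p]
    · refine (norm_add_le _ _).trans (le_trans ?_ (le_max_right _ _))
      rw [norm_smul, Real.norm_of_nonneg ht0.le]
      nlinarith [ht1.2, mul_nonneg (mul_nonneg ht0.le hev.K_pos.le) (norm_nonneg p),
        mul_nonneg ht0.le hev.K_pos.le]
  refine ⟨q, hq, fun p => le_antisymm ?_ (h8 p)⟩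
  have h9 := h8 (-p)
  have h10 : ∫ θ, ψ θ * (ev (-p) θ / ev q θ) ∂circleMeasure
      = -∫ θ, ψ θ * (ev p θ / ev q θ) ∂circleMeasure := by
    rw [← integral_neg]
    refine integral_congr_ae (Eventually.of_forall fun θ => ?_)
    simp only [map_neg, ContinuousMap.neg_apply]
    ring
  rw [h10, map_neg] at h9
  linarith

/-- Stationary points depend on the functional in a locally Lipschitz way. -/
theorem IsStationary.exists_norm_sub_le (hψ : IsWeight ψ c M) (hev : IsLipschitzFamily ev K)
    {L : E →L[ℝ] ℝ} (hL : IsPositive ev L) {q : E} (hq : IsStationary ψ ev L q) :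
    ∃ ε m C, 0 < ε ∧ 0 < m ∧ ∀ (L' : E →L[ℝ] ℝ) (q' : E), ‖L' - L‖ ≤ ε →
      IsStationary ψ ev L' q' → (∀ θ, m ≤ ev q' θ) ∧ ‖q' - q‖ ≤ C * ‖L' - L‖ := by
  obtain ⟨δ, hδ, hδL⟩ := hL.exists_mul_norm_le
  obtain ⟨κ, hκ, hκE⟩ := exists_mul_norm_sq_le_integral_sq hev
  -- From (δ/2)‖q'‖ ≤ L' q' = ∫ψ ≤ M. The next bound takes q in the role of q₀, since ∫ψ q/q' = L' q
  -- ≤ L q + (δ/2)‖q‖.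
  set R := 2 * M / δ with hR
  obtain ⟨m, hm, hmR⟩ := exists_lower_bound hψ hev hq.1 R (L q + δ / 2 * ‖q‖)
  have hM : 0 < M := hψ.c_pos.trans_le hψ.le
  have hR0 : 0 < R := by positivity
  have hc := hψ.c_pos
  have hK := hev.K_pos
  refine ⟨δ / 2, m, (K * (‖q‖ + 1)) * (K * R) / (c * κ), half_pos hδ, hm, fun L' q' hL' hq' => ?_⟩
  have hdiff : ∀ p : E, |L' p - L p| ≤ ‖L' - L‖ * ‖p‖ := fun p => (L' - L).le_opNorm p
  have hdiff' : ∀ p : E, |L' p - L p| ≤ δ / 2 * ‖p‖ := fun p =>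
    (hdiff p).trans (mul_le_mul_of_nonneg_right hL' (norm_nonneg p))
  have h1 : ‖q'‖ ≤ R := by
    have h2 := hδL q' fun θ => (hq'.1 θ).le
    have h3 := (abs_le.1 (hdiff' q')).1
    have h4 := hq'.apply_self
    have h5 := hψ.integral_le
    rw [hR, le_div_iff₀ hδ]
    linarith
  have h2 : ∀ θ, m ≤ ev q' θ := hmR q' hq'.1 h1 (by
    rw [← hq'.2 q]
    linarith [(abs_le.1 (hdiff' q)).2])
  refine ⟨h2, ?_⟩
  set d := q' - q with hd
  have h3 : L d - L' d = ∫ θ, ψ θ * ((ev d θ) ^ 2 / (ev q θ * ev q' θ)) ∂circleMeasure := by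
    rw [hq.2, hq'.2, ← integral_sub (hψ.integrable_mul (continuous_div_of_pos hq.1))
      (hψ.integrable_mul (continuous_div_of_pos hq'.1))]
    refine integral_congr_ae (Eventually.of_forall fun θ => ?_)
    have h4 := (hq.1 θ).ne'
    have h5 := (hq'.1 θ).ne'
    have h6 : ev d θ = ev q' θ - ev q θ := by simp [hd]
    simp only [h6]
    field_simp
  have hqR : 0 < (K * (‖q‖ + 1)) * (K * R) := by positivity
  have hdc : Continuous fun θ => (ev d θ) ^ 2 := (ev d).continuous.pow 2
  -- Strong monotonicity: q ≤ K(‖q‖ + 1), where the 1 only ensures positivity, and q' ≤ KR.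
  have h4 : c * (κ * ‖d‖ ^ 2) / ((K * (‖q‖ + 1)) * (K * R)) ≤ L d - L' d := by
    rw [h3]
    have h5 := hψ.mul_integral_le (f := fun θ => (ev d θ) ^ 2 / ((K * (‖q‖ + 1)) * (K * R)))
      (hdc.div_const _) (fun θ => by positivity)
    have h6 : ∫ θ, ψ θ * ((ev d θ) ^ 2 / ((K * (‖q‖ + 1)) * (K * R))) ∂circleMeasure
        ≤ ∫ θ, ψ θ * ((ev d θ) ^ 2 / (ev q θ * ev q' θ)) ∂circleMeasure := by
      refine hψ.integral_mul_mono (hdc.div_const _) (hdc.div ((ev q).continuous.mul (ev q').continuous)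
        fun θ => (mul_pos (hq.1 θ) (hq'.1 θ)).ne') fun θ => ?_
      refine div_le_div_of_nonneg_left (sq_nonneg _) (mul_pos (hq.1 θ) (hq'.1 θ)) ?_
      refine mul_le_mul ?_ ?_ (hq'.1 θ).le (by positivity)
      · have := (le_abs_self _).trans (hev.abs_le q θ)
        linarith
      · exact (le_abs_self _).trans ((hev.abs_le q' θ).trans
          (mul_le_mul_of_nonneg_left h1 hK.le))
    rw [integral_div] at h5
    refine le_trans ?_ (h5.trans h6)
    rw [mul_div_assoc]
    exact mul_le_mul_of_nonneg_left
      (div_le_div_of_nonneg_right (hκE d) hqR.le) hc.le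
  have h5 : L d - L' d ≤ ‖L' - L‖ * ‖d‖ := by
    linarith [(abs_le.1 (hdiff d)).1]
  rcases eq_or_lt_of_le (norm_nonneg d) with h0 | h0
  · rw [← h0]
    positivity
  have h6 := h4.trans h5
  rw [div_le_iff₀ hqR] at h6
  rw [div_mul_eq_mul_div, le_div_iff₀ (mul_pos hc hκ)]
  refine le_of_mul_le_mul_right ?_ h0
  linarith

end Dual

/-! ### Covariances as linear functionals on the functions Re(G^*ΛG). -/

section Moment

open ComplexConjugate

variable {n : ℕ} {A : Matrix (Fin n) (Fin n) ℂ} {b : Fin n → ℂ}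

theorem norm_circlePoint (θ : Torus) : ‖circlePoint θ‖ = 1 :=
  Circle.norm_coe _

theorem circlePoint_coe (t : ℝ) : circlePoint (t : Torus) = Complex.exp (t * Complex.I) := by
  rw [circlePoint, AddCircle.toCircle_apply_mk, div_self Real.two_pi_pos.ne', one_mul,
    Circle.coe_exp]

theorem continuous_circlePoint : Continuous circlePoint :=
  continuous_subtype_val.comp AddCircle.continuous_toCircle

theorem exists_circlePoint_eq {z : ℂ} (hz : ‖z‖ = 1) : ∃ θ, circlePoint θ = z := by
  refine ⟨(Complex.arg z : Torus), ?_⟩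
  rw [circlePoint_coe]
  have := Complex.norm_mul_exp_arg_mul_I z
  rwa [hz, Complex.ofReal_one, one_mul] at this

theorem transfer_circlePoint (hA : IsStability A) (b : Fin n → ℂ) (θ : Torus) (i : Fin n) :
    transfer A b (circlePoint θ) i
      = (transferNum A b i).eval (circlePoint θ) / A.charpoly.eval (circlePoint θ) :=
  transfer_eq_div b (charpoly_eval_ne_zero hA (norm_circlePoint θ)) i

theorem continuous_transfer (hA : IsStability A) (b : Fin n → ℂ) (i : Fin n) :
    Continuous fun θ => transfer A b (circlePoint θ) i := by
  simp only [transfer_circlePoint hA]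
  exact ((transferNum A b i).continuous.comp continuous_circlePoint).div
    (A.charpoly.continuous.comp continuous_circlePoint)
    fun θ => charpoly_eval_ne_zero hA (norm_circlePoint θ)

theorem contDiff_transfer (hA : IsStability A) (b : Fin n → ℂ) (i : Fin n) :
    ContDiff ℝ 1 fun t : ℝ => transfer A b (circlePoint (t : Torus)) i := by
  simp only [transfer_circlePoint hA]
  have he : ContDiff ℝ 1 fun t : ℝ => Complex.exp (t * Complex.I) :=
    (Complex.ofRealCLM.contDiff.mul contDiff_const).cexp
  have hp : ∀ p : Polynomial ℂ, ContDiff ℝ 1 fun t : ℝ => p.eval (circlePoint (t : Torus)) :=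
    fun p => by
      simp only [circlePoint_coe]
      have h1 : ContDiff ℂ 1 fun z : ℂ => p.eval z := by
        simpa using p.contDiff_aeval (𝕜 := ℂ) 1
      exact (h1.restrict_scalars ℝ).comp he
  simp only [div_eq_mul_inv]
  refine (hp _).mul ((hp _).inv fun t => ?_)
  exact charpoly_eval_ne_zero hA (norm_circlePoint _)

theorem exists_lipschitz_of_contDiff {f : Torus → ℝ}
    (hf : ContDiff ℝ 1 fun t : ℝ => f (t : Torus)) :
    ∃ C, 0 ≤ C ∧ ∀ s t : ℝ, |f (s : Torus) - f (t : Torus)| ≤ C * |s - t| := by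
  set g : ℝ → ℝ := fun t => f (t : Torus) with hg
  have hper : Function.Periodic g (2 * Real.pi) := fun t => by
    simp [hg]
  have hper' : Function.Periodic (deriv g) (2 * Real.pi) := fun t => by
    rw [← deriv_comp_add_const]
    congr 1
    ext s
    exact hper s
  obtain ⟨C, hC⟩ := (hper'.isBounded_of_continuous Real.two_pi_pos.ne'
    hf.continuous_deriv_one).exists_norm_le
  refine ⟨C, (norm_nonneg _).trans (hC (deriv g 0) ⟨0, rfl⟩), fun s t => ?_⟩
  exact Convex.norm_image_sub_le_of_norm_deriv_le
    (fun x _ => (hf.differentiable one_ne_zero) x) (fun x _ => hC _ ⟨x, rfl⟩) convex_univ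
    (Set.mem_univ t) (Set.mem_univ s)

/-- The map `Λ ↦ Re (G^* Λ G)`. -/
noncomputable def quadMap (hA : IsStability A) (b : Fin n → ℂ) :
    Matrix (Fin n) (Fin n) ℂ →ₗ[ℝ] C(Torus, ℝ) where
  toFun Λ := ⟨fun θ => quadForm Λ (transfer A b (circlePoint θ)), by
    have := continuous_transfer hA b
    unfold quadForm
    fun_prop⟩
  map_add' Λ Λ' := by
    ext θ
    simp [quadForm, add_mul, Finset.sum_add_distrib]
  map_smul' r Λ := by
    ext θ
    simp only [quadForm, Matrix.smul_apply, Complex.real_smul, mul_assoc, ← Finset.mul_sum,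
      ContinuousMap.coe_mk, ContinuousMap.smul_apply, Complex.re_ofReal_mul, RingHom.id_apply,
      smul_eq_mul]

theorem quadMap_apply (hA : IsStability A) (Λ : Matrix (Fin n) (Fin n) ℂ) (θ : Torus) :
    quadMap hA b Λ θ = quadForm Λ (transfer A b (circlePoint θ)) := rfl

theorem contDiff_quadMap (hA : IsStability A) (Λ : Matrix (Fin n) (Fin n) ℂ) :
    ContDiff ℝ 1 fun t : ℝ => quadMap hA b Λ (t : Torus) := by
  have h := contDiff_transfer hA b
  simp only [quadMap_apply, quadForm]
  refine Complex.reCLM.contDiff.comp (ContDiff.sum fun i _ => ContDiff.sum fun j _ => ?_)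
  exact contDiff_const.mul ((h j).mul (Complex.conjCLE.contDiff.comp (h i)))

/-- The pairing `Re tr (Λ S)`. -/
noncomputable def tracePairing :
    Matrix (Fin n) (Fin n) ℂ →ₗ[ℝ] Matrix (Fin n) (Fin n) ℂ →ₗ[ℝ] ℝ :=
  LinearMap.mk₂ ℝ (fun S Λ => (∑ i, ∑ j, Λ i j * S j i).re)
    (fun S S' Λ => by simp [mul_add, Finset.sum_add_distrib])
    (fun r S Λ => by
      simp only [Matrix.smul_apply, Complex.real_smul, mul_left_comm _ (r : ℂ), ← Finset.mul_sum,
        Complex.re_ofReal_mul, smul_eq_mul])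
    (fun S Λ Λ' => by simp [add_mul, Finset.sum_add_distrib])
    (fun r S Λ => by
      simp only [Matrix.smul_apply, Complex.real_smul, mul_assoc, ← Finset.mul_sum,
        Complex.re_ofReal_mul, smul_eq_mul])

theorem tracePairing_apply (S Λ : Matrix (Fin n) (Fin n) ℂ) :
    tracePairing S Λ = (∑ i, ∑ j, Λ i j * S j i).re := rfl

/-- The pairing sees only real parts, so each entry is tested with the matrix units multiplied by 1
and by i. -/
theorem eq_of_tracePairing_eq {S S' : Matrix (Fin n) (Fin n) ℂ}
    (h : ∀ Λ, tracePairing S Λ = tracePairing S' Λ) : S = S' := by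
  ext i j
  have hs : ∀ (T : Matrix (Fin n) (Fin n) ℂ) (c : ℂ),
      tracePairing T (Matrix.single j i c) = (c * T i j).re := fun T c => by
    rw [tracePairing_apply, Finset.sum_eq_single j, Finset.sum_eq_single i]
    · simp
    · intro k _ hk
      simp [hk.symm]
    · simp
    · intro k _ hk
      simp [hk.symm]
    · simp
  refine Complex.ext ?_ ?_
  · simpa [hs] using h (Matrix.single j i 1)
  · simpa [hs] using h (Matrix.single j i Complex.I)

/-- The moment map Φ ↦ ∫GΦG^* and Λ ↦ Re(G^*ΛG) are adjoint to each other. -/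
theorem tracePairing_stateCov (hA : IsStability A) (b : Fin n → ℂ) {Φ : Torus → ℝ}
    (hΦ : Integrable Φ circleMeasure) (Λ : Matrix (Fin n) (Fin n) ℂ) :
    tracePairing (stateCov A b Φ) Λ = ∫ θ, Φ θ * quadMap hA b Λ θ ∂circleMeasure := by
  set G : Fin n → Torus → ℂ := fun i θ => transfer A b (circlePoint θ) i with hG
  have hGc : ∀ i, Continuous (G i) := continuous_transfer hA b
  have hint : ∀ i j, Integrable (fun θ => Λ i j * (G j θ * (Φ θ : ℂ) * star (G i θ)))
      circleMeasure := fun i j => by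
    have hc : Continuous fun θ => Λ i j * (G j θ * star (G i θ)) := by
      have := hGc i; have := hGc j; fun_prop
    obtain ⟨D, hD⟩ := isCompact_univ.exists_bound_of_continuousOn hc.continuousOn
    refine (hΦ.ofReal.mul_bdd (c := D) hc.aestronglyMeasurable
      (Eventually.of_forall fun θ => hD θ trivial)).congr (Eventually.of_forall fun θ => ?_)
    simp only [Complex.coe_algebraMap]
    ring
  have h1 : ∑ i, ∑ j, Λ i j * stateCov A b Φ j i
      = ∫ θ, ∑ i, ∑ j, Λ i j * (G j θ * (Φ θ : ℂ) * star (G i θ)) ∂circleMeasure := by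
    rw [integral_finsetSum _ fun i _ => integrable_finsetSum _ fun j _ => hint i j]
    refine Finset.sum_congr rfl fun i _ => ?_
    rw [integral_finsetSum _ fun j _ => hint i j]
    refine Finset.sum_congr rfl fun j _ => ?_
    rw [integral_const_mul]
    rfl
  have h2 : Integrable (fun θ => ∑ i, ∑ j, Λ i j * (G j θ * (Φ θ : ℂ) * star (G i θ)))
      circleMeasure := integrable_finsetSum _ fun i _ => integrable_finsetSum _ fun j _ => hint i j
  rw [tracePairing_apply, h1]
  refine (integral_re h2).symm.trans (integral_congr_ae (Eventually.of_forall fun θ => ?_))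
  simp only [quadMap_apply, quadForm]
  rw [← Complex.re_ofReal_mul, Finset.mul_sum]
  refine congrArg Complex.re (Finset.sum_congr rfl fun i _ => ?_)
  rw [Finset.mul_sum]
  refine Finset.sum_congr rfl fun j _ => ?_
  simp only [hG, Complex.star_def]
  ring

/-- This is where S must lie in the range of the moment map: its pairing with Λ then depends only on
the function Re(G^*ΛG). -/
theorem tracePairing_eq_of_mem_PGamma (hA : IsStability A) {S : Matrix (Fin n) (Fin n) ℂ}
    (hS : S ∈ PGamma A b) {Λ Λ' : Matrix (Fin n) (Fin n) ℂ}
    (h : quadMap hA b Λ = quadMap hA b Λ') : tracePairing S Λ = tracePairing S Λ' := by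
  obtain ⟨-, Φ, rfl⟩ := hS
  have hΦ := integrable_circle_of_continuous Φ.continuous
  rw [tracePairing_stateCov hA b hΦ, tracePairing_stateCov hA b hΦ, h]

/-- Fejér–Riesz lets Λ be replaced by the rank-one matrix āaᵀ, which gives the same function; its
pairing with S is aᵀSā. -/
theorem tracePairing_pos_of_mem_PGamma (hn : 0 < n) (hA : IsStability A) (hAb : IsReachable A b)
    {S : Matrix (Fin n) (Fin n) ℂ} (hS : S ∈ PGamma A b) {Λ : Matrix (Fin n) (Fin n) ℂ}
    (h0 : ∀ θ, 0 ≤ quadMap hA b Λ θ) (hne : quadMap hA b Λ ≠ 0) : 0 < tracePairing S Λ := by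
  obtain ⟨a, ha⟩ := exists_quadForm_transfer_eq_norm_sq hn hA hAb (Λ := Λ) fun z hz => by
    obtain ⟨θ, rfl⟩ := exists_circlePoint_eq hz
    exact h0 θ
  have ha0 : star a ≠ 0 := by
    intro h
    rw [star_eq_zero] at h
    refine hne (ContinuousMap.ext fun θ => ?_)
    rw [quadMap_apply, ha _ (norm_circlePoint θ), h]
    simp
  have h1 : quadMap hA b Λ = quadMap hA b (Matrix.of fun i j => conj (a i) * a j) := by
    ext θ
    rw [quadMap_apply, ha _ (norm_circlePoint θ), quadMap_apply, quadForm]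
    have h2 : ∑ i, ∑ j, Matrix.of (fun i j => conj (a i) * a j) i j *
        (transfer A b (circlePoint θ) j * conj (transfer A b (circlePoint θ) i))
        = ((‖a ⬝ᵥ transfer A b (circlePoint θ)‖ ^ 2 : ℝ) : ℂ) := by
      rw [← Complex.normSq_eq_norm_sq, ← Complex.mul_conj, mul_comm, dotProduct, map_sum,
        Finset.sum_mul_sum]
      refine Finset.sum_congr rfl fun i _ => Finset.sum_congr rfl fun j _ => ?_
      simp only [Matrix.of_apply, map_mul]
      ring
    rw [h2, Complex.ofReal_re]
  rw [tracePairing_eq_of_mem_PGamma hA hS h1]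
  have h3 := hS.1.re_dotProduct_pos ha0
  convert h3 using 1
  rw [tracePairing_apply, Finset.sum_comm]
  refine congrArg Complex.re (Finset.sum_congr rfl fun j _ => ?_)
  rw [star_star, Matrix.mulVec, dotProduct, Finset.mul_sum]
  refine Finset.sum_congr rfl fun i _ => ?_
  simp only [Matrix.of_apply, Pi.star_apply, Complex.star_def]
  ring

/-- Distinct Λ may give the same function, for instance when they differ by a skew-Hermitian matrix.
A linear section over the range gives coordinates that determine the function and are determined by
it. -/
theorem exists_parametrization (hA : IsStability A) (b : Fin n → ℂ) :
    ∃ (r : ℕ) (lin : (Fin r → ℝ) →ₗ[ℝ] Matrix (Fin n) (Fin n) ℂ),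
      Function.Injective (quadMap hA b ∘ₗ lin) ∧
      ∀ Λ, ∃ x, quadMap hA b (lin x) = quadMap hA b Λ := by
  set f := quadMap hA b
  obtain ⟨g, hg⟩ := f.rangeRestrict.exists_rightInverse_of_surjective f.range_rangeRestrict
  let e := (Module.finBasis ℝ f.range).equivFun
  have hfg : ∀ y, f (g y) = y := fun y => congrArg Subtype.val (LinearMap.congr_fun hg y)
  refine ⟨_, g ∘ₗ e.symm.toLinearMap, fun x y hxy => ?_, fun Λ => ⟨e (f.rangeRestrict Λ), ?_⟩⟩
  · have h1 : f (g (e.symm x)) = f (g (e.symm y)) := hxy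
    rw [hfg, hfg] at h1
    exact e.symm.injective (Subtype.ext h1)
  · change f (g (e.symm (e (f.rangeRestrict Λ)))) = f Λ
    rw [e.symm_apply_apply, hfg]
    rfl

theorem exists_isLipschitzFamily (hA : IsStability A) {r : ℕ}
    {lin : (Fin r → ℝ) →ₗ[ℝ] Matrix (Fin n) (Fin n) ℂ}
    (hinj : Function.Injective (quadMap hA b ∘ₗ lin)) :
    ∃ K, IsLipschitzFamily (quadMap hA b ∘ₗ lin) K := by
  set ev := quadMap hA b ∘ₗ lin with hev
  have hL : ∀ k : Fin r, ∃ C, 0 ≤ C ∧ ∀ s t : ℝ,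
      |ev (Pi.single k 1) (s : Torus) - ev (Pi.single k 1) (t : Torus)| ≤ C * |s - t| :=
    fun k => exists_lipschitz_of_contDiff (contDiff_quadMap hA _)
  choose C hC0 hC using hL
  have hsum : ∀ (x : Fin r → ℝ) θ, ev x θ = ∑ k, x k * ev (Pi.single k 1) θ := fun x θ => by
    have h1 : x = ∑ k, x k • Pi.single (M := fun _ => ℝ) k 1 := pi_eq_sum_univ' x
    conv_lhs => rw [h1]
    simp [map_sum, ContinuousMap.sum_apply]
  have hx : ∀ (x : Fin r → ℝ) k, |x k| ≤ ‖x‖ := fun x k => norm_le_pi_norm x k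
  set D : Fin r → ℝ := fun k => ‖ev (Pi.single k 1)‖ with hD
  have hD0 : ∀ k, 0 ≤ D k := fun k => norm_nonneg _
  refine ⟨∑ k, (C k + D k) + 1, ?_, hinj, fun x θ => ?_, fun x s t => ?_⟩
  · have := Finset.sum_nonneg fun k (_ : k ∈ Finset.univ) => add_nonneg (hC0 k) (hD0 k)
    linarith
  · rw [hsum]
    calc |∑ k, x k * ev (Pi.single k 1) θ| ≤ ∑ k, |x k * ev (Pi.single k 1) θ| :=
          Finset.abs_sum_le_sum_abs _ _
      _ ≤ ∑ k, (C k + D k) * ‖x‖ := Finset.sum_le_sum fun k _ => by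
          rw [abs_mul, mul_comm]
          refine mul_le_mul ?_ (hx x k) (abs_nonneg _) (add_nonneg (hC0 k) (hD0 k))
          have := (ev (Pi.single k 1)).norm_coe_le_norm θ
          rw [Real.norm_eq_abs] at this
          linarith [hC0 k]
      _ ≤ _ := by
          rw [← Finset.sum_mul]
          nlinarith [norm_nonneg x]
  · rw [hsum, hsum, ← Finset.sum_sub_distrib]
    calc |∑ k, (x k * ev (Pi.single k 1) (s : Torus) - x k * ev (Pi.single k 1) (t : Torus))|
        ≤ ∑ k, |x k * ev (Pi.single k 1) (s : Torus) - x k * ev (Pi.single k 1) (t : Torus)| :=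
          Finset.abs_sum_le_sum_abs _ _
      _ ≤ ∑ k, (C k + D k) * (‖x‖ * |s - t|) := Finset.sum_le_sum fun k _ => by
          rw [← mul_sub, abs_mul]
          calc |x k| * _ ≤ ‖x‖ * (C k * |s - t|) :=
                mul_le_mul (hx x k) (hC k s t) (abs_nonneg _) (norm_nonneg _)
            _ = C k * (‖x‖ * |s - t|) := by ring
            _ ≤ _ := mul_le_mul_of_nonneg_right (by linarith [hD0 k])
                (mul_nonneg (norm_nonneg _) (abs_nonneg _))
      _ ≤ _ := by
          rw [← Finset.sum_mul, mul_assoc]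
          exact mul_le_mul_of_nonneg_right (by linarith)
            (mul_nonneg (norm_nonneg _) (abs_nonneg _))

/-- Here q = |G|², and G has no zero on the circle because (zI − A)N = χb ≠ 0. It supplies the
positive reference function q₀ of the dual problem. -/
theorem quadMap_one_pos (hA : IsStability A) (hb : b ≠ 0) (θ : Torus) :
    0 < quadMap hA b 1 θ := by
  have hG : transfer A b (circlePoint θ) ≠ 0 := by
    intro h
    have h1 : (fun i => (transferNum A b i).eval (circlePoint θ)) = 0 := by
      ext i
      have hχ := charpoly_eval_ne_zero hA (norm_circlePoint θ)
      have h2 := transfer_circlePoint hA b θ i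
      rw [h, Pi.zero_apply, eq_comm, div_eq_zero_iff] at h2
      exact h2.resolve_right hχ
    have h2 := eval_charpoly_smul A b (circlePoint θ)
    rw [h1, Matrix.mulVec_zero] at h2
    exact (smul_ne_zero (charpoly_eval_ne_zero hA (norm_circlePoint θ)) hb) h2.symm
  have h1 : quadMap hA b 1 θ = ∑ i, ‖transfer A b (circlePoint θ) i‖ ^ 2 := by
    rw [quadMap_apply, quadForm, Complex.re_sum]
    refine Finset.sum_congr rfl fun i _ => ?_
    rw [Finset.sum_eq_single i (fun j _ hj => by simp [Matrix.one_apply_ne hj.symm]) (by simp),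
      Matrix.one_apply_eq, one_mul, Complex.mul_conj, Complex.normSq_eq_norm_sq, Complex.ofReal_re]
  rw [h1]
  obtain ⟨i, hi⟩ := Function.ne_iff.1 hG
  refine Finset.sum_pos' (fun i _ => by positivity) ⟨i, Finset.mem_univ i, ?_⟩
  exact pow_pos (norm_pos_iff.2 hi) 2

/-- The functional `x ↦ Re tr (lin x S)` as a linear function of `S`. -/
noncomputable def momentFunctional {r : ℕ}
    (lin : (Fin r → ℝ) →ₗ[ℝ] Matrix (Fin n) (Fin n) ℂ) :
    Matrix (Fin n) (Fin n) ℂ →ₗ[ℝ] ((Fin r → ℝ) →L[ℝ] ℝ) :=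
  LinearMap.toContinuousLinearMap.toLinearMap ∘ₗ (tracePairing.compl₂ lin)

theorem momentFunctional_apply {r : ℕ} (lin : (Fin r → ℝ) →ₗ[ℝ] Matrix (Fin n) (Fin n) ℂ)
    (S : Matrix (Fin n) (Fin n) ℂ) (x : Fin r → ℝ) :
    momentFunctional lin S x = tracePairing S (lin x) := rfl

theorem isPositive_momentFunctional (hn : 0 < n) (hA : IsStability A) (hAb : IsReachable A b)
    {r : ℕ} {lin : (Fin r → ℝ) →ₗ[ℝ] Matrix (Fin n) (Fin n) ℂ}
    (hinj : Function.Injective (quadMap hA b ∘ₗ lin)) {S : Matrix (Fin n) (Fin n) ℂ}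
    (hS : S ∈ PGamma A b) : IsPositive (quadMap hA b ∘ₗ lin) (momentFunctional lin S) :=
  fun _ hx hx0 => tracePairing_pos_of_mem_PGamma hn hA hAb hS hx fun h =>
    hx0 (hinj (h.trans (map_zero _).symm))

theorem continuous_momentFunctional {r : ℕ}
    (lin : (Fin r → ℝ) →ₗ[ℝ] Matrix (Fin n) (Fin n) ℂ) : Continuous (momentFunctional lin) :=
  (momentFunctional lin).continuous_of_finiteDimensional

end Moment

/-! ### Back to spectral densities: optimality, uniqueness, continuity in the covariance. -/

section Primal

theorem exists_isWeight {Ψ : LInf} (hΨ : Ψ ∈ spectralDensities) : ∃ c M, IsWeight Ψ c M := by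
  obtain ⟨c, hc, hΨc⟩ := hΨ
  refine ⟨c, (eLpNorm Ψ ∞ circleMeasure).toReal, Lp.aestronglyMeasurable Ψ, hc, hΨc, ?_⟩
  have h : ∀ᵐ θ ∂circleMeasure, ‖Ψ θ‖ₑ ≤ eLpNorm Ψ ∞ circleMeasure := by
    rw [eLpNorm_exponent_top]
    exact ae_le_eLpNormEssSup
  filter_upwards [h] with θ hθ
  rw [← ofReal_norm, ENNReal.ofReal_le_iff_le_toReal (Lp.eLpNorm_ne_top Ψ)] at hθ
  exact (Real.le_norm_self _).trans hθ

theorem norm_le_of_ae_abs_le {f : LInf} {C : ℝ} (hC : 0 ≤ C)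
    (h : ∀ᵐ θ ∂circleMeasure, |f θ| ≤ C) : ‖f‖ ≤ C := by
  simpa using Lp.norm_le_of_ae_bound (f := f) hC h

theorem IsWeight.integrable_mul_log_div {ψ φ : Torus → ℝ} {c M c' M' : ℝ} (hψ : IsWeight ψ c M)
    (hφ : IsWeight φ c' M') : Integrable (fun θ => ψ θ * Real.log (ψ θ / φ θ)) circleMeasure := by
  refine hψ.integrable.mul_bdd
    (c := |Real.log c| + |Real.log M| + (|Real.log c'| + |Real.log M'|))
    (Real.measurable_log.comp_aemeasurable
      (hψ.meas.aemeasurable.div hφ.meas.aemeasurable)).aestronglyMeasurable ?_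
  have key : ∀ {x a b : ℝ}, 0 < a → a ≤ x → x ≤ b →
      |Real.log x| ≤ |Real.log a| + |Real.log b| := fun {x a b} ha hax hxb => by
    have h1 := Real.log_le_log ha hax
    have h2 := Real.log_le_log (ha.trans_le hax) hxb
    rw [abs_le]
    constructor
    · linarith [neg_abs_le (Real.log a), abs_nonneg (Real.log b)]
    · linarith [le_abs_self (Real.log b), abs_nonneg (Real.log a)]
  filter_upwards [hψ.lower, hψ.upper, hφ.lower, hφ.upper] with θ h1 h2 h3 h4
  rw [Real.norm_eq_abs, Real.log_div (hψ.c_pos.trans_le h1).ne' (hφ.c_pos.trans_le h3).ne']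
  exact (abs_sub _ _).trans (add_le_add (key hψ.c_pos h1 h2) (key hφ.c_pos h3 h4))

variable {n : ℕ} {A : Matrix (Fin n) (Fin n) ℂ} {b : Fin n → ℂ} {r : ℕ}
  {lin : (Fin r → ℝ) →ₗ[ℝ] Matrix (Fin n) (Fin n) ℂ}

/-- The optimal spectral density has the form `Ψ / q`. -/
theorem exists_coeFn_eq_div {Ψ : LInf} {c M : ℝ} (hΨ : IsWeight Ψ c M) {q : C(Torus, ℝ)}
    (hq : ∀ θ, 0 < q θ) :
    ∃ Φ : LInf, Φ ∈ spectralDensities ∧ ∀ᵐ θ ∂circleMeasure, Φ θ = Ψ θ / q θ := by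
  obtain ⟨m, hm, hmq⟩ := exists_pos_le_of_pos hq
  have hM := hΨ.c_pos.trans_le hΨ.le
  have hmem : MemLp (fun θ => Ψ θ / q θ) ∞ circleMeasure := by
    refine memLp_top_of_bound (hΨ.meas.aemeasurable.div
      q.continuous.measurable.aemeasurable).aestronglyMeasurable (M / m) ?_
    filter_upwards [hΨ.nonneg, hΨ.upper] with θ h1 h2
    rw [Real.norm_of_nonneg (div_nonneg h1 (hq θ).le)]
    exact div_le_div₀ hM.le h2 hm (hmq θ)
  refine ⟨hmem.toLp _, ⟨c / (‖q‖ + 1), div_pos hΨ.c_pos (by positivity), ?_⟩, hmem.coeFn_toLp⟩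
  filter_upwards [hmem.coeFn_toLp, hΨ.lower] with θ h1 h2
  rw [h1]
  refine div_le_div₀ (hΨ.c_pos.le.trans h2) h2 (hq θ) ?_
  linarith [le_abs_self (q θ), q.norm_coe_le_norm θ, Real.norm_eq_abs (q θ)]

theorem stateCov_eq_of_isStationary (hA : IsStability A)
    (hsurj : ∀ Λ, ∃ x, quadMap hA b (lin x) = quadMap hA b Λ) {Ψ Φ : LInf}
    (hΦ : Φ ∈ spectralDensities)
    {S : Matrix (Fin n) (Fin n) ℂ} (hS : S ∈ PGamma A b) {q : Fin r → ℝ}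
    (hq : IsStationary Ψ (quadMap hA b ∘ₗ lin) (momentFunctional lin S) q)
    (hΦq : ∀ᵐ θ ∂circleMeasure, Φ θ = Ψ θ / quadMap hA b (lin q) θ) : stateCov A b Φ = S := by
  obtain ⟨c', M', hΦw⟩ := exists_isWeight hΦ
  refine eq_of_tracePairing_eq fun Λ => ?_
  obtain ⟨x, hx⟩ := hsurj Λ
  rw [tracePairing_stateCov hA b hΦw.integrable, ← tracePairing_eq_of_mem_PGamma hA hS hx,
    ← momentFunctional_apply, hq.2 x, ← hx]
  refine integral_congr_ae ?_
  filter_upwards [hΦq] with θ hθ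
  rw [hθ, LinearMap.comp_apply, LinearMap.comp_apply]
  ring

theorem isKLSolution_of_isStationary (hA : IsStability A)
    (hsurj : ∀ Λ, ∃ x, quadMap hA b (lin x) = quadMap hA b Λ) {Ψ Φ : LInf}
    (hΨ : Ψ ∈ spectralDensities) (hΦ : Φ ∈ spectralDensities)
    {S : Matrix (Fin n) (Fin n) ℂ} (hS : S ∈ PGamma A b) {q : Fin r → ℝ}
    (hq : IsStationary Ψ (quadMap hA b ∘ₗ lin) (momentFunctional lin S) q)
    (hΦq : ∀ᵐ θ ∂circleMeasure, Φ θ = Ψ θ / quadMap hA b (lin q) θ) :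
    IsKLSolution A b Ψ S Φ ∧ ∀ Φ', IsKLSolution A b Ψ S Φ' → Φ' = Φ := by
  have hcov := stateCov_eq_of_isStationary hA hsurj hΦ hS hq hΦq
  have hfeas : Φ ∈ feasible A b S := ⟨hΦ, hcov⟩
  obtain ⟨c, M, hΨw⟩ := exists_isWeight hΨ
  obtain ⟨c₁, M₁, hΦw⟩ := exists_isWeight hΦ
  have hqpos : ∀ θ, 0 < quadMap hA b (lin q) θ := hq.1
  have key : ∀ Φ' ∈ feasible A b S, klDist Ψ Φ ≤ klDist Ψ Φ' ∧
      (klDist Ψ Φ' ≤ klDist Ψ Φ → Φ' = Φ) := by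
    intro Φ' hΦ'
    obtain ⟨c₂, M₂, hΦw'⟩ := exists_isWeight hΦ'.1
    -- The first bracket integrates to zero by the moment constraint. Adding it to the difference of
    -- the integrands makes h = Ψ(x − 1 − log x), with x = Φ'q/Ψ, nonnegative pointwise.
    set h : Torus → ℝ := fun θ => (Φ' θ * quadMap hA b (lin q) θ - Ψ θ)
      + (Ψ θ * Real.log (Ψ θ / Φ' θ) - Ψ θ * Real.log (Ψ θ / Φ θ)) with hh
    have hi1 := hΨw.integrable_mul_log_div hΦw'
    have hi2 := hΨw.integrable_mul_log_div hΦw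
    have hi3 := hΦw'.integrable_mul (quadMap hA b (lin q)).continuous
    have hi : Integrable h circleMeasure := (hi3.sub hΨw.integrable).add (hi1.sub hi2)
    have hint : ∫ θ, h θ ∂circleMeasure = klDist Ψ Φ' - klDist Ψ Φ := by
      have h1 : ∫ θ, Φ' θ * quadMap hA b (lin q) θ ∂circleMeasure
          = ∫ θ, Ψ θ ∂circleMeasure := by
        rw [← tracePairing_stateCov hA b hΦw'.integrable, hΦ'.2, ← momentFunctional_apply,
          hq.apply_self]
      refine (integral_add (hi3.sub hΨw.integrable) (hi1.sub hi2)).trans ?_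
      refine (congrArg₂ (· + ·) (integral_sub hi3 hΨw.integrable) (integral_sub hi1 hi2)).trans ?_
      simp only [h1, sub_self, zero_add]
      rfl
    have hpt : ∀ᵐ θ ∂circleMeasure, 0 ≤ h θ ∧ (h θ = 0 → Φ' θ = Φ θ) := by
      filter_upwards [hΦq, hΨw.lower, hΦw'.lower] with θ h1 h2 h3
      have hψ0 : 0 < Ψ θ := hΨw.c_pos.trans_le h2
      have hφ0 : 0 < Φ' θ := hΦw'.c_pos.trans_le h3
      have hq0 := hqpos θ
      set y := quadMap hA b (lin q) θ
      have h4 : Ψ θ / Φ θ = y := by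
        rw [h1]
        field_simp
      set x := Φ' θ * y / Ψ θ with hx
      have hx0 : 0 < x := by positivity
      have h5 : h θ = Ψ θ * (x - 1 - Real.log x) := by
        have h6 : Ψ θ / Φ' θ = y / x := by
          rw [hx]
          field_simp
        rw [hh]
        simp only [h4, h6]
        rw [Real.log_div hq0.ne' hx0.ne']
        have h7 : Ψ θ * x = Φ' θ * y := by
          rw [hx]
          field_simp
        linear_combination -h7
      refine ⟨?_, fun h0 => ?_⟩
      · rw [h5]
        exact mul_nonneg hψ0.le (by linarith [Real.log_le_sub_one_of_pos hx0])
      · have h6 : x = 1 := by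
          by_contra hne
          have h7 := Real.log_lt_sub_one_of_pos hx0 hne
          rw [h5] at h0
          rcases mul_eq_zero.1 h0 with h8 | h8
          · exact hψ0.ne' h8
          · linarith
        rw [h1, eq_div_iff hq0.ne']
        rwa [hx, div_eq_one_iff_eq hψ0.ne'] at h6
    have hnn : 0 ≤ᵐ[circleMeasure] h := hpt.mono fun _ hθ => hθ.1
    have h0 := integral_nonneg_of_ae hnn
    refine ⟨by linarith, fun hle => ?_⟩
    have h1 : ∫ θ, h θ ∂circleMeasure = 0 := le_antisymm (by linarith) h0
    rw [integral_eq_zero_iff_of_nonneg_ae hnn hi] at h1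
    refine Lp.ext ?_
    filter_upwards [hpt, h1] with θ h2 h3
    exact h2.2 h3
  exact ⟨⟨hfeas, fun Φ' hΦ' => (key Φ' hΦ').1⟩, fun Φ' hΦ' => (key Φ' hΦ'.1).2 (hΦ'.2 Φ hfeas)⟩

theorem klOpt_eq {Ψ Φ : LInf} {S : Matrix (Fin n) (Fin n) ℂ} (h : IsKLSolution A b Ψ S Φ)
    (huniq : ∀ Φ', IsKLSolution A b Ψ S Φ' → Φ' = Φ) : klOpt A b Ψ S = Φ := by
  have hex : ∃ Φ, IsKLSolution A b Ψ S Φ := ⟨Φ, h⟩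
  rw [klOpt, dif_pos hex]
  exact huniq _ hex.choose_spec

theorem existsUnique_isKLSolution_and_continuousOn (hA : IsStability A) (hb : b ≠ 0)
    (hAb : IsReachable A b) {Ψ : LInf} (hΨ : Ψ ∈ spectralDensities) :
    (∀ S ∈ PGamma A b, ∃! Φ : LInf, IsKLSolution A b Ψ S Φ) ∧
      ContinuousOn (klOpt A b Ψ) (PGamma A b) := by
  have hn : 0 < n := by
    rcases Nat.eq_zero_or_pos n with rfl | h
    · exact absurd (Subsingleton.elim b 0) hb
    · exact h
  obtain ⟨c, M, hΨw⟩ := exists_isWeight hΨ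
  have hM : 0 < M := hΨw.c_pos.trans_le hΨw.le
  obtain ⟨r, lin, hinj, hsurj⟩ := exists_parametrization hA b
  obtain ⟨K, hev⟩ := exists_isLipschitzFamily hA hinj
  obtain ⟨x₀, hx₀⟩ := hsurj 1
  have hx₀pos : ∀ θ, 0 < (quadMap hA b ∘ₗ lin) x₀ θ := fun θ => by
    rw [LinearMap.comp_apply, hx₀]
    exact quadMap_one_pos hA hb θ
  have hsol : ∀ S ∈ PGamma A b, ∃ (q : Fin r → ℝ) (Φ : LInf),
      IsStationary Ψ (quadMap hA b ∘ₗ lin) (momentFunctional lin S) q ∧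
      (∀ᵐ θ ∂circleMeasure, Φ θ = Ψ θ / quadMap hA b (lin q) θ) ∧
      IsKLSolution A b Ψ S Φ ∧ ∀ Φ', IsKLSolution A b Ψ S Φ' → Φ' = Φ := by
    intro S hS
    obtain ⟨q, hq⟩ := exists_isStationary hΨw hev hx₀pos
      (isPositive_momentFunctional hn hA hAb hinj hS)
    obtain ⟨Φ, hΦ, hΦq⟩ := exists_coeFn_eq_div hΨw (q := quadMap hA b (lin q)) hq.1
    exact ⟨q, Φ, hq, hΦq, isKLSolution_of_isStationary hA hsurj hΨ hΦ hS hq hΦq⟩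
  refine ⟨fun S hS => ?_, fun S hS => ?_⟩
  · obtain ⟨q, Φ, -, -, h1, h2⟩ := hsol S hS
    exact ⟨Φ, h1, h2⟩
  obtain ⟨q, Φ, hq, hΦq, hΦ, hΦu⟩ := hsol S hS
  obtain ⟨ε, m', C, hε, hm', hC⟩ := hq.exists_norm_sub_le hΨw hev
    (isPositive_momentFunctional hn hA hAb hinj hS)
  obtain ⟨m, hm, hmq⟩ := exists_pos_le_of_pos hq.1
  have hlim : Tendsto (fun T => ‖momentFunctional lin T - momentFunctional lin S‖)
      (𝓝[PGamma A b] S) (𝓝 0) := by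
    have h1 : Continuous fun T => ‖momentFunctional lin T - momentFunctional lin S‖ :=
      ((continuous_momentFunctional lin).sub continuous_const).norm
    have h2 := h1.tendsto S
    simp only [sub_self, norm_zero] at h2
    exact h2.mono_left nhdsWithin_le_nhds
  rw [ContinuousWithinAt, tendsto_iff_norm_sub_tendsto_zero]
  refine squeeze_zero' (g := fun T =>
    M / (m * m') * (K * (C * ‖momentFunctional lin T - momentFunctional lin S‖)))
    (Eventually.of_forall fun _ => norm_nonneg _) ?_ ?_
  · filter_upwards [self_mem_nhdsWithin, hlim.eventually (ge_mem_nhds hε)] with T hT hTε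
    obtain ⟨q', Φ', hq', hΦq', hΦ', hΦu'⟩ := hsol T hT
    obtain ⟨hmq', hqq'⟩ := hC _ q' hTε hq'
    rw [klOpt_eq hΦ hΦu, klOpt_eq hΦ' hΦu']
    have hd0 : 0 ≤ C * ‖momentFunctional lin T - momentFunctional lin S‖ :=
      (norm_nonneg _).trans hqq'
    have hK := hev.K_pos
    refine norm_le_of_ae_abs_le (by positivity) ?_
    filter_upwards [Lp.coeFn_sub Φ' Φ, hΦq, hΦq', hΨw.nonneg, hΨw.upper] with θ h1 h2 h3 h4 h5
    have hy0 : 0 < quadMap hA b (lin q) θ := hq.1 θ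
    have hy0' : 0 < quadMap hA b (lin q') θ := hq'.1 θ
    have hy := hmq θ
    have hy' := hmq' θ
    have hyy : |quadMap hA b (lin q') θ - quadMap hA b (lin q) θ|
        ≤ K * (C * ‖momentFunctional lin T - momentFunctional lin S‖) := by
      have h6 := hev.abs_le (q' - q) θ
      rw [map_sub, ContinuousMap.sub_apply] at h6
      exact h6.trans (mul_le_mul_of_nonneg_left hqq' hK.le)
    rw [LinearMap.comp_apply] at hy hy'
    rw [h1, Pi.sub_apply, h2, h3]
    set y := quadMap hA b (lin q) θ
    set y' := quadMap hA b (lin q') θ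
    have h7 : Ψ θ / y' - Ψ θ / y = Ψ θ / (y * y') * (y - y') := by
      field_simp
    rw [h7, abs_mul, abs_sub_comm y, abs_of_nonneg (by positivity)]
    refine mul_le_mul ?_ hyy (abs_nonneg _) (by positivity)
    exact div_le_div₀ hM.le h5 (by positivity) (mul_le_mul hy hy' hm'.le hy0.le)
  · have := ((hlim.const_mul C).const_mul K).const_mul (M / (m * m'))
    simpa using this

end Primal

end KLSpectrum

/-! ### Almost sure consistency. -/

theorem mainTheorem8 {n : ℕ} (A : Matrix (Fin n) (Fin n) ℂ) (b : Fin n → ℂ)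
    (hA : KLSpectrum.IsStability A) (hb : b ≠ 0) (hAb : KLSpectrum.IsReachable A b)
    (Ψ : KLSpectrum.LInf) (hΨ : Ψ ∈ KLSpectrum.spectralDensities) :
    (∀ S ∈ KLSpectrum.PGamma A b, ∃! Φ : KLSpectrum.LInf, KLSpectrum.IsKLSolution A b Ψ S Φ) ∧
    ∀ {Ω : Type*} [MeasurableSpace Ω] (P : Measure Ω) [IsProbabilityMeasure P]
      (x : ℕ → Ω → (Fin n → ℂ))
      (Sbar : (N : ℕ) → (Fin N → (Fin n → ℂ)) → Matrix (Fin n) (Fin n) ℂ)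
      (Sig : Matrix (Fin n) (Fin n) ℂ), Sig ∈ KLSpectrum.PGamma A b →
      (∀ N : ℕ, 1 ≤ N →
        ∀ᵐ ω ∂P, Sbar N (fun k : Fin N => x (k + 1) ω) ∈ KLSpectrum.PGamma A b) →
      (∀ᵐ ω ∂P, Tendsto (fun N : ℕ => Sbar N (fun k : Fin N => x (k + 1) ω)) atTop (𝓝 Sig)) →
      ∀ᵐ ω ∂P, Tendsto
        (fun N : ℕ =>
          ‖KLSpectrum.klOpt A b Ψ (Sbar N (fun k : Fin N => x (k + 1) ω))
            - KLSpectrum.klOpt A b Ψ Sig‖)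
        atTop (𝓝 0) := by
  obtain ⟨hex, hcont⟩ :=
    KLSpectrum.existsUnique_isKLSolution_and_continuousOn hA hb hAb hΨ
  refine ⟨hex, fun P _ x Sbar Sig hSig hmem hlim => ?_⟩
  -- Countably many null sets are merged, so that almost every path eventually lies in `PGamma`, the
  -- set on which the optimum is continuous.
  have hmem' : ∀ᵐ ω ∂P, ∀ N : ℕ, 1 ≤ N →
      Sbar N (fun k : Fin N => x (k + 1) ω) ∈ KLSpectrum.PGamma A b := by
    rw [ae_all_iff]
    intro N
    by_cases hN : 1 ≤ N
    · exact (hmem N hN).mono fun _ h _ => h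
    · exact Eventually.of_forall fun _ h => absurd h hN
  filter_upwards [hmem', hlim] with ω h1 h2
  have h3 : Tendsto (fun N : ℕ => Sbar N (fun k : Fin N => x (k + 1) ω)) atTop
      (𝓝[KLSpectrum.PGamma A b] Sig) :=
    tendsto_nhdsWithin_iff.2 ⟨h2, (eventually_ge_atTop 1).mono h1⟩
  exact tendsto_iff_norm_sub_tendsto_zero.1 ((hcont Sig hSig).tendsto.comp h3)
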